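/- Let $\mathbb{K}$ be a field of characteristic $0$. A Jacobi diagram on two strands $\downarrow\downarrow$ (two disjoint oriented intervals, numbered $1,2$) is a (possibly empty, not necessarily connected) finite uni-trivalent graph whose univalent vertices are attached to distinct points of the interiors of the two intervals and whose trivalent vertices are equipped with cyclic orders, considered up to isomorphism (in particular only the order of the univalent vertices along each interval matters). Let $\mathcal{A}(\downarrow\downarrow)_{\mathbb{K}}$ be the $\mathbb{K}$-vector space generated by Jacobi diagrams on $\downarrow\downarrow$ modulo the AS, IHX and STU relations. Here AS says that reversing the cyclic order at one trivalent vertex changes the sign. IHX is $I-H+X=0$ for three diagrams that differ only near one edge joining two trivalent vertices: with inner edge $e$ and outer edges $a,b,c,d$, the cyclic orders at the two ends of $e$ are $(e,b,a),(e,c,d)$ in $I$, $(e,a,c),(e,d,b)$ in $H$, and $(e,b,c),(e,d,a)$ in $X$. STU is $S-T+U=0$ for three diagrams that differ only near one place of an interval: in $T$ (resp. $U$) two edges $a,b$ end there at consecutive points in the order $a,b$ (resp. $b,a$) along the orientation, while in $S$ a single edge $e$ ends there, whose other end is a trivalent vertex with cyclic order $(e,b,a)$. Let $\mathfrak{sl}_2=\mathfrak{sl}_2(\mathbb{K})$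 be equipped with the trace form $B_0(x,y)=\operatorname{tr}(xy)$, and let $U(\mathfrak{sl}_2)$ be its universal enveloping algebra. Let $\{v_1,v_2,v_3\}$ be any basis of $\mathfrak{sl}_2$, with $B_0$-dual basis $\{v_1^*,v_2^*,v_3^*\}$. The universal $\mathfrak{sl}_2$ weight system associated with $(\mathfrak{sl}_2,B_0)$ is the well-defined linear map $$W_{\mathfrak{sl}_2}\colon \mathcal{A}(\downarrow\downarrow)_{\mathbb{K}}\to U(\mathfrak{sl}_2)^{\otimes 2}$$ that sends a Jacobi diagram $J$ to the following element. Put on the two ends of each edge of $J$ the two factors of the Casimir tensor $\sum_a v_a\otimes v_a^{*}=\sum_{a,c}B_0(v_a^*,v_c^*)\,v_a\otimes v_c$ and expand multilinearly. In every resulting term, each trivalent vertex whose three half-edges, in cyclic order, carry the vectors $x,y,z$ contributes the scalar $-B_0([x,y],z)$, and the univalent vertices contribute $p_1\otimes p_2$, where $p_i$ is the product in $U(\mathfrak{sl}_2)$ of the vectors on the univalent vertices of the $i$-th interval, in the order of its orientation (an empty product is $1$). Sum all the terms. Then the image of $W_{\mathfrak{sl}_2}$ is commutative, i.e. $uv=vu$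 in $U(\mathfrak{sl}_2)^{\otimes 2}$ for all $u,v\in\operatorname{Im}W_{\mathfrak{sl}_2}$. -/

import Mathlib

open scoped TensorProduct
open LieAlgebra.SpecialLinear (sl)

/-! ### Jacobi diagrams on two strands -/

/-- The half-edges occurring in a list of edges. -/
def edgeEnds (E : List (ℕ × ℕ)) : List ℕ := E.flatMap fun e => [e.1, e.2]

/-- The half-edges occurring in a list of trivalent vertices. -/
def vertEnds (V : List (ℕ × ℕ × ℕ)) : List ℕ := V.flatMap fun t => [t.1, t.2.1, t.2.2]

/-- A presentation of a Jacobi diagram based on two oriented intervals.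
The half-edges of the uni-trivalent graph are labelled by distinct natural numbers.
* `edges` lists the edges, each as the pair of its two half-edges;
* `verts` lists the trivalent vertices, each as the triple of its three half-edges, written in
  an order that represents the cyclic order of the vertex;
* `legs i` lists the univalent vertices on the `i`-th interval, each given by its half-edge, in
  the order of the orientation of the interval.

Every half-edge lies on exactly one edge and at exactly one vertex. -/
structure JacobiDiagram where
  edges : List (ℕ × ℕ)
  verts : List (ℕ × ℕ × ℕ)
  legs : Fin 2 → List ℕ
  nodup : (edgeEnds edges).Nodup
  perm : (edgeEnds edges).Perm (vertEnds verts ++ legs 0 ++ legs 1)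

namespace JacobiDiagram

/-- Two presentations give the same Jacobi diagram: some relabelling of the half-edges matches the
(unordered) edges, the trivalent vertices with their cyclic orders, and the ordered sequence of
univalent vertices on each interval. -/
def Iso (D D' : JacobiDiagram) : Prop :=
  ∃ f : Equiv.Perm ℕ,
    (D'.edges.map fun e => s(e.1, e.2)).Perm (D.edges.map fun e => s(f e.1, f e.2)) ∧
    (D'.verts.map fun t => (([t.1, t.2.1, t.2.2] : List ℕ) : Cycle ℕ)).Perm
      (D.verts.map fun t => (([f t.1, f t.2.1, f t.2.2] : List ℕ) : Cycle ℕ)) ∧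
    ∀ i, D'.legs i = (D.legs i).map f

end JacobiDiagram

/-- The defining relations of the space of Jacobi diagrams. Vertices are written in
counterclockwise order. In `ihx` the four outer half-edges are `a` (top left), `b` (top right),
`c` (bottom left), `d` (bottom right), and `(x, y)` is the inner edge. In `stu` the half-edges `a`
(left) and `b` (right) end at the new vertex of `S`, whose third edge `(x, y)` ends on the
interval, respectively they end on the interval at consecutive places, in the order `a, b` in `T`
and in the order `b, a` in `U`. -/
inductive JacobiRel (K : Type*) [Field K] : (JacobiDiagram →₀ K) → Prop
  | iso (D D' : JacobiDiagram) (h : D.Iso D') :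
      JacobiRel K (Finsupp.single D 1 - Finsupp.single D' 1)
  | as (D D' : JacobiDiagram) (a b c : ℕ) (V : List (ℕ × ℕ × ℕ))
      (hV : D.verts = (a, b, c) :: V) (hV' : D'.verts = (b, a, c) :: V)
      (hE : D'.edges = D.edges) (hL : D'.legs = D.legs) :
      JacobiRel K (Finsupp.single D 1 + Finsupp.single D' 1)
  | ihx (I H X : JacobiDiagram) (x y a b c d : ℕ) (E : List (ℕ × ℕ)) (V : List (ℕ × ℕ × ℕ))
      (hE : I.edges = (x, y) :: E)
      (hI : I.verts = (x, b, a) :: (y, c, d) :: V)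
      (hH : H.verts = (x, a, c) :: (y, d, b) :: V)
      (hX : X.verts = (x, b, c) :: (y, d, a) :: V)
      (hEH : H.edges = I.edges) (hEX : X.edges = I.edges)
      (hLH : H.legs = I.legs) (hLX : X.legs = I.legs) :
      JacobiRel K (Finsupp.single I 1 - Finsupp.single H 1 + Finsupp.single X 1)
  | stu (S T U : JacobiDiagram) (x y a b : ℕ) (i : Fin 2) (L R : List ℕ)
      (hE : S.edges = (x, y) :: T.edges) (hV : S.verts = (x, b, a) :: T.verts)
      (hS : S.legs = Function.update T.legs i (L ++ y :: R))
      (hT : T.legs i = L ++ a :: b :: R)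
      (hEU : U.edges = T.edges) (hVU : U.verts = T.verts)
      (hU : U.legs = Function.update T.legs i (L ++ b :: a :: R)) :
      JacobiRel K (Finsupp.single S 1 - Finsupp.single T 1 + Finsupp.single U 1)

/-- The `K`-vector space of Jacobi diagrams on two parallel oriented intervals: formal linear
combinations of Jacobi diagrams modulo isomorphism and the AS, IHX and STU relations. -/
abbrev JacobiSpace (K : Type*) [Field K] : Type _ :=
  (JacobiDiagram →₀ K) ⧸ Submodule.span K {r : JacobiDiagram →₀ K | JacobiRel K r}

/-! ### Metrized Lie algebras -/

/-- An ad-invariant symmetric non-degenerate bilinear form on a Lie algebra. -/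
structure LieMetric (K 𝔤 : Type*) [Field K] [LieRing 𝔤] [LieAlgebra K 𝔤] where
  form : LinearMap.BilinForm K 𝔤
  symm : form.IsSymm
  nondegenerate : form.Nondegenerate
  invariant : ∀ x y z : 𝔤, form ⁅z, x⁆ y + form x ⁅z, y⁆ = 0

section WeightSystem

variable {K 𝔤 ι : Type*} [Field K] [LieRing 𝔤] [LieAlgebra K 𝔤] [Fintype ι] [DecidableEq ι]

/-- The basis dual to `b` with respect to the metric. -/
noncomputable def LieMetric.dual (B : LieMetric K 𝔤) (b : Module.Basis ι K 𝔤) :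
    Module.Basis ι K 𝔤 :=
  LinearMap.BilinForm.dualBasis B.form B.nondegenerate b

/-- The coefficients of the quadratic Casimir tensor
`∑ i, b i ⊗ B.dual b i = ∑ i, ∑ j, B.casimirCoeff b i j • (b i ⊗ b j)`.
For an orthonormal basis this is the identity matrix. -/
noncomputable def LieMetric.casimirCoeff (B : LieMetric K 𝔤) (b : Module.Basis ι K 𝔤)
    (i j : ι) : K :=
  B.form (B.dual b i) (B.dual b j)

theorem LieMetric.sum_form_dual (B : LieMetric K 𝔤) (b : Module.Basis ι K 𝔤) (z : 𝔤) :
    ∑ i, B.form (b i) z • B.dual b i = z := by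
  conv_rhs => rw [← (B.dual b).sum_repr z]
  refine Finset.sum_congr rfl fun i _ => ?_
  rw [LieMetric.dual, LinearMap.BilinForm.dualBasis_repr_apply, B.symm.eq z (b i)]

theorem LieMetric.dual_eq (B : LieMetric K 𝔤) (b : Module.Basis ι K 𝔤) (i : ι) :
    ∑ j, B.casimirCoeff b i j • b j = B.dual b i := by
  conv_rhs => rw [← b.sum_repr (B.dual b i)]
  refine Finset.sum_congr rfl fun j _ => ?_
  have h := LinearMap.BilinForm.dualBasis_repr_apply (B := B.form) B.nondegenerate
    (B.dual b) (B.dual b i) j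
  rw [LieMetric.dual, LinearMap.BilinForm.dualBasis_dualBasis B.nondegenerate B.symm] at h
  rw [LieMetric.casimirCoeff, LieMetric.dual, h]

theorem LieMetric.casimir_eq (B : LieMetric K 𝔤) (b : Module.Basis ι K 𝔤) :
    ∑ i, ∑ j, B.casimirCoeff b i j • (b i ⊗ₜ[K] b j) = ∑ i, b i ⊗ₜ[K] B.dual b i := by
  refine Finset.sum_congr rfl fun i _ => ?_
  rw [← B.dual_eq b i, TensorProduct.tmul_sum]
  simp only [TensorProduct.tmul_smul]

theorem LieMetric.casimirCoeff_comm (B : LieMetric K 𝔤) (b : Module.Basis ι K 𝔤) (i j : ι) :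
    B.casimirCoeff b i j = B.casimirCoeff b j i := B.symm.eq _ _

/-- Contraction with the Casimir tensor: evaluating `F` on two slots filled by the Casimir
tensor. -/
theorem LieMetric.sum_casimir (B : LieMetric K 𝔤) (b : Module.Basis ι K 𝔤) (z w : 𝔤) :
    ∑ i, ∑ j, (B.casimirCoeff b i j * (B.form (b i) z * B.form (b j) w)) = B.form z w := by
  have h (i : ι) : ∑ j, (B.casimirCoeff b i j * (B.form (b i) z * B.form (b j) w)) =
      B.form (b i) z * B.form (B.dual b i) w := by
    rw [← B.dual_eq b i]
    simp only [map_sum, LinearMap.sum_apply, map_smul, LinearMap.smul_apply, smul_eq_mul,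
      Finset.mul_sum]
    exact Finset.sum_congr rfl fun j _ => by ring
  simp only [h]
  conv_rhs => rw [← B.sum_form_dual b z]
  simp only [map_sum, LinearMap.sum_apply, map_smul, LinearMap.smul_apply, smul_eq_mul]

/-- The product in `U(𝔤)` of the vectors assigned to a sequence of univalent vertices. -/
noncomputable def legProd (K : Type*) {𝔤 : Type*} [Field K] [LieRing 𝔤] [LieAlgebra K 𝔤]
    (φ : ℕ → 𝔤) (l : List ℕ) : UniversalEnvelopingAlgebra K 𝔤 :=
  (l.map fun h => UniversalEnvelopingAlgebra.ι K (φ h)).prod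

/-- The contribution of the vertices, when the vector `φ h` is assigned to the half-edge `h`:
each trivalent vertex `(h₁, h₂, h₃)` contributes the scalar `-⟨[φ h₁, φ h₂], φ h₃⟩`, and the
univalent vertices contribute the tensor product over the two intervals of the products of their
vectors along the interval. -/
noncomputable def vertexValue (B : LieMetric K 𝔤) (V : List (ℕ × ℕ × ℕ)) (legs : Fin 2 → List ℕ)
    (φ : ℕ → 𝔤) : UniversalEnvelopingAlgebra K 𝔤 ⊗[K] UniversalEnvelopingAlgebra K 𝔤 :=
  (V.map fun t => -B.form ⁅φ t.1, φ t.2.1⁆ (φ t.2.2)).prod •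
    (legProd K φ (legs 0) ⊗ₜ[K] legProd K φ (legs 1))

/-- The sum over all states: the two half-edges of each edge are filled with the Casimir tensor
`∑ i, ∑ j, B.casimirCoeff b i j • (b i ⊗ b j)`, one edge after the other. -/
noncomputable def edgeSum {M : Type*} [AddCommGroup M] [Module K M] (B : LieMetric K 𝔤)
    (b : Module.Basis ι K 𝔤) (F : (ℕ → 𝔤) → M) : List (ℕ × ℕ) → (ℕ → 𝔤) → M
  | [], φ => F φ
  | (p, q) :: E, φ => ∑ i, ∑ j, B.casimirCoeff b i j •
      edgeSum B b F E (Function.update (Function.update φ p (b i)) q (b j))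

/-- The value of the universal weight system on a Jacobi diagram. Every half-edge lies on an edge,
so the initial assignment `0` is overwritten everywhere. -/
noncomputable def weight (B : LieMetric K 𝔤) (b : Module.Basis ι K 𝔤) (D : JacobiDiagram) :
    UniversalEnvelopingAlgebra K 𝔤 ⊗[K] UniversalEnvelopingAlgebra K 𝔤 :=
  edgeSum B b (vertexValue B D.verts D.legs) D.edges 0

/-! #### The weight respects the relations -/

section edgeSum

variable {M : Type*} [AddCommGroup M] [Module K M] (B : LieMetric K 𝔤) (b : Module.Basis ι K 𝔤)

theorem edgeSum_add (F G : (ℕ → 𝔤) → M) (E : List (ℕ × ℕ)) (φ : ℕ → 𝔤) :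
    edgeSum B b (fun ψ => F ψ + G ψ) E φ = edgeSum B b F E φ + edgeSum B b G E φ := by
  induction E generalizing φ with
  | nil => rfl
  | cons e E ih =>
    obtain ⟨p, q⟩ := e
    simp only [edgeSum, ih, smul_add, Finset.sum_add_distrib]

theorem edgeSum_neg (F : (ℕ → 𝔤) → M) (E : List (ℕ × ℕ)) (φ : ℕ → 𝔤) :
    edgeSum B b (fun ψ => -F ψ) E φ = -edgeSum B b F E φ := by
  induction E generalizing φ with
  | nil => rfl
  | cons e E ih =>
    obtain ⟨p, q⟩ := e
    simp only [edgeSum, ih, smul_neg, Finset.sum_neg_distrib]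

theorem edgeSum_zero (E : List (ℕ × ℕ)) (φ : ℕ → 𝔤) :
    edgeSum B b (fun _ => (0 : M)) E φ = 0 := by
  induction E generalizing φ with
  | nil => rfl
  | cons e E ih =>
    obtain ⟨p, q⟩ := e
    simp only [edgeSum, ih, smul_zero, Finset.sum_const_zero]

theorem edgeSum_swap (F : (ℕ → 𝔤) → M) (p q r s : ℕ) (E : List (ℕ × ℕ)) (φ : ℕ → 𝔤)
    (hpr : p ≠ r) (hps : p ≠ s) (hqr : q ≠ r) (hqs : q ≠ s) :
    edgeSum B b F ((p, q) :: (r, s) :: E) φ = edgeSum B b F ((r, s) :: (p, q) :: E) φ := by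
  simp only [edgeSum, Finset.smul_sum]
  have key (i j k l : ι) :
      Function.update (Function.update (Function.update (Function.update φ p (b i)) q (b j))
        r (b k)) s (b l) =
      Function.update (Function.update (Function.update (Function.update φ r (b k)) s (b l))
        p (b i)) q (b j) := by
    funext h
    simp only [Function.update_apply]
    grind
  simp only [key]
  have hcomm (f : ι → ι → ι → ι → M) :
      ∑ i, ∑ j, ∑ k, ∑ l, f i j k l = ∑ k, ∑ l, ∑ i, ∑ j, f i j k l := by
    calc ∑ i, ∑ j, ∑ k, ∑ l, f i j k l = ∑ i, ∑ k, ∑ j, ∑ l, f i j k l :=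
          Finset.sum_congr rfl fun i _ => Finset.sum_comm
      _ = ∑ k, ∑ i, ∑ j, ∑ l, f i j k l := Finset.sum_comm
      _ = ∑ k, ∑ i, ∑ l, ∑ j, f i j k l :=
          Finset.sum_congr rfl fun k _ => Finset.sum_congr rfl fun i _ => Finset.sum_comm
      _ = ∑ k, ∑ l, ∑ i, ∑ j, f i j k l := Finset.sum_congr rfl fun k _ => Finset.sum_comm
  rw [hcomm]
  refine Finset.sum_congr rfl fun k _ => Finset.sum_congr rfl fun l _ =>
    Finset.sum_congr rfl fun i _ => Finset.sum_congr rfl fun j _ => ?_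
  rw [smul_comm]

theorem edgeSum_flip (F : (ℕ → 𝔤) → M) (p q : ℕ) (E : List (ℕ × ℕ)) (φ : ℕ → 𝔤) (h : p ≠ q) :
    edgeSum B b F ((p, q) :: E) φ = edgeSum B b F ((q, p) :: E) φ := by
  simp only [edgeSum]
  rw [Finset.sum_comm]
  refine Finset.sum_congr rfl fun i _ => Finset.sum_congr rfl fun j _ => ?_
  rw [B.casimirCoeff_comm, Function.update_comm h]

theorem edgeSum_cons (F : (ℕ → 𝔤) → M) (p q : ℕ) (E : List (ℕ × ℕ)) (φ : ℕ → 𝔤)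
    (hp : p ∉ edgeEnds E) (hq : q ∉ edgeEnds E) :
    edgeSum B b F ((p, q) :: E) φ = edgeSum B b (fun ψ => edgeSum B b F [(p, q)] ψ) E φ := by
  induction E generalizing φ with
  | nil => rfl
  | cons e E ih =>
    obtain ⟨r, s⟩ := e
    simp only [edgeEnds, List.flatMap_cons, List.cons_append, List.nil_append, List.mem_cons,
      not_or] at hp hq
    rw [edgeSum_swap B b F p q r s E φ hp.1 hp.2.1 hq.1 hq.2.1, edgeSum, edgeSum]
    refine Finset.sum_congr rfl fun i _ => Finset.sum_congr rfl fun j _ => ?_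
    rw [ih _ hp.2.2 hq.2.2]

theorem edgeEnds_perm {E E' : List (ℕ × ℕ)} (h : E.Perm E') :
    (edgeEnds E).Perm (edgeEnds E') := h.flatMap_right _

theorem edgeSum_perm (F : (ℕ → 𝔤) → M) {E E' : List (ℕ × ℕ)} (h : E.Perm E')
    (hE : (edgeEnds E).Nodup) (φ : ℕ → 𝔤) : edgeSum B b F E φ = edgeSum B b F E' φ := by
  induction h generalizing φ with
  | nil => rfl
  | cons e _ ih =>
    obtain ⟨p, q⟩ := e
    simp only [edgeEnds, List.flatMap_cons] at hE
    simp only [edgeSum, ih (List.Nodup.of_append_right hE)]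
  | swap e f E =>
    obtain ⟨p, q⟩ := e
    obtain ⟨r, s⟩ := f
    simp only [edgeEnds, List.flatMap_cons, List.cons_append, List.nil_append, List.nodup_cons,
      List.mem_cons, not_or] at hE
    obtain ⟨h1, h2, -⟩ := hE
    exact edgeSum_swap B b F r s p q E φ h1.2.1 h1.2.2.1 h2.1 h2.2.1
  | trans h1 _ ih1 ih2 =>
    rw [ih1 hE, ih2 ((edgeEnds_perm h1).nodup hE)]

theorem edgeSum_sym2 (F : (ℕ → 𝔤) → M) (E E' : List (ℕ × ℕ)) (hE : (edgeEnds E).Nodup)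
    (h : (E.map fun e => s(e.1, e.2)).Perm (E'.map fun e => s(e.1, e.2))) (φ : ℕ → 𝔤) :
    edgeSum B b F E φ = edgeSum B b F E' φ := by
  induction E' generalizing E φ with
  | nil =>
    simp only [List.map_nil, List.perm_nil, List.map_eq_nil_iff] at h
    rw [h]
  | cons e' E' ih =>
    have hmem : s(e'.1, e'.2) ∈ E.map fun e => s(e.1, e.2) := h.symm.subset (by simp)
    obtain ⟨e, he, hee⟩ := List.mem_map.1 hmem
    obtain ⟨A, C, rfl⟩ := List.append_of_mem he
    have hp : (A ++ e :: C).Perm (e :: (A ++ C)) := List.perm_middle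
    have hnd := (edgeEnds_perm hp).nodup hE
    have h2 := ((hp.map fun e : ℕ × ℕ => s(e.1, e.2)).symm.trans h)
    rw [List.map_cons, List.map_cons, hee, List.perm_cons] at h2
    obtain ⟨p, q⟩ := e
    obtain ⟨r, s⟩ := e'
    have hnd' := hnd
    simp only [edgeEnds, List.flatMap_cons, List.cons_append, List.nil_append,
      List.nodup_cons] at hnd'
    have hstep (ψ : ℕ → 𝔤) := ih (A ++ C) hnd'.2.2 h2 ψ
    have hpq : p ≠ q := fun hpq => hnd'.1 (by simp [hpq])
    rw [edgeSum_perm B b F hp hE]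
    have htail : edgeSum B b F ((p, q) :: (A ++ C)) φ = edgeSum B b F ((p, q) :: E') φ := by
      simp only [edgeSum, hstep]
    rw [htail]
    rcases Sym2.eq_iff.1 hee with ⟨h1, h2⟩ | ⟨h1, h2⟩
    · simp only at h1 h2
      rw [h1, h2]
    · simp only at h1 h2
      rw [edgeSum_flip B b F p q E' φ hpq, h1, h2]

theorem edgeSum_relabel (F : (ℕ → 𝔤) → M) (f : Equiv.Perm ℕ) (E : List (ℕ × ℕ)) (φ : ℕ → 𝔤) :
    edgeSum B b (fun ψ => F (ψ ∘ f)) (E.map fun e => (f e.1, f e.2)) φ =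
      edgeSum B b F E (φ ∘ f) := by
  induction E generalizing φ with
  | nil => rfl
  | cons e E ih =>
    obtain ⟨p, q⟩ := e
    simp only [List.map_cons, edgeSum, ih]
    refine Finset.sum_congr rfl fun i _ => Finset.sum_congr rfl fun j _ => ?_
    congr 2
    funext h
    simp [Function.update_apply, f.injective.eq_iff]

end edgeSum

theorem LieMetric.rotate (B : LieMetric K 𝔤) (x y z : 𝔤) :
    B.form ⁅x, y⁆ z = B.form ⁅y, z⁆ x := by
  have h := B.invariant x z y
  rw [← lie_skew x y, map_neg, LinearMap.neg_apply, B.symm.eq ⁅y, z⁆ x]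
  exact neg_eq_of_add_eq_zero_right h

theorem legProd_comp (φ : ℕ → 𝔤) (f : ℕ → ℕ) (l : List ℕ) :
    legProd K φ (l.map f) = legProd K (φ ∘ f) l := by
  simp [legProd, Function.comp_def]

theorem weight_iso (B : LieMetric K 𝔤) (b : Module.Basis ι K 𝔤) {D D' : JacobiDiagram}
    (h : D.Iso D') : weight B b D' = weight B b D := by
  obtain ⟨f, hE, hV, hL⟩ := h
  have hval : vertexValue B D'.verts D'.legs =
      fun ψ => vertexValue B D.verts D.legs (ψ ∘ f) := by
    funext ψ
    rw [vertexValue, vertexValue, hL, hL, legProd_comp, legProd_comp]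
    congr 1
    let cyc : ℕ × ℕ × ℕ → Cycle ℕ := fun t => (([t.1, t.2.1, t.2.2] : List ℕ) : Cycle ℕ)
    let w : ℕ × ℕ × ℕ → K := fun t => -B.form ⁅ψ t.1, ψ t.2.1⁆ (ψ t.2.2)
    have hw : Function.FactorsThrough w cyc := by
      rintro ⟨p, q, r⟩ ⟨p', q', r'⟩ h
      obtain ⟨n, hn, hr⟩ := List.isRotated_iff_mod.1 (Cycle.coe_eq_coe.1 h)
      simp only [List.length_cons, List.length_nil] at hn
      interval_cases n <;> simp at hr <;> obtain ⟨rfl, rfl, rfl⟩ := hr <;> simp only [w]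
      · rw [B.rotate]
      · rw [B.rotate, B.rotate]
    have h1 := (hV.map (Function.extend cyc w 0)).prod_eq
    rw [List.map_map, List.map_map] at h1
    have h2 : D'.verts.map w = D'.verts.map (Function.extend cyc w 0 ∘ cyc) :=
      List.map_congr_left fun t _ => (hw.extend_apply 0 t).symm
    have h3 : (D.verts.map fun t => w (f t.1, f t.2.1, f t.2.2)) =
        D.verts.map (Function.extend cyc w 0 ∘ fun t => cyc (f t.1, f t.2.1, f t.2.2)) :=
      List.map_congr_left fun t _ => (hw.extend_apply 0 (f t.1, f t.2.1, f t.2.2)).symm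
    exact (congrArg List.prod h2).trans (h1.trans (congrArg List.prod h3).symm)
  rw [weight, weight, hval, edgeSum_sym2 B b _ D'.edges (D.edges.map fun e => (f e.1, f e.2))
    D'.nodup (by rw [List.map_map]; exact hE), edgeSum_relabel]
  rfl

theorem legProd_update (φ : ℕ → 𝔤) (l : List ℕ) (p : ℕ) (v : 𝔤) (hp : p ∉ l) :
    legProd K (Function.update φ p v) l = legProd K φ l := by
  rw [legProd, legProd]
  congr 1
  refine List.map_congr_left fun h hh => ?_
  have hne : h ≠ p := fun e => hp (by rw [← e]; exact hh)
  rw [Function.update_of_ne hne]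

theorem vertProd_update (B : LieMetric K 𝔤) (φ : ℕ → 𝔤) (V : List (ℕ × ℕ × ℕ)) (p : ℕ) (v : 𝔤)
    (hp : p ∉ vertEnds V) :
    (V.map fun t => -B.form ⁅Function.update φ p v t.1, Function.update φ p v t.2.1⁆
      (Function.update φ p v t.2.2)).prod =
    (V.map fun t => -B.form ⁅φ t.1, φ t.2.1⁆ (φ t.2.2)).prod := by
  congr 1
  refine List.map_congr_left fun t ht => ?_
  have hmem (h : ℕ) (hh : h ∈ [t.1, t.2.1, t.2.2]) : h ≠ p := fun e =>
    hp (List.mem_flatMap.2 ⟨t, ht, e ▸ hh⟩)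
  rw [Function.update_of_ne (hmem _ (by simp)), Function.update_of_ne (hmem _ (by simp)),
    Function.update_of_ne (hmem _ (by simp))]

theorem vertexValue_cons (B : LieMetric K 𝔤) (t : ℕ × ℕ × ℕ) (V : List (ℕ × ℕ × ℕ))
    (legs : Fin 2 → List ℕ) (φ : ℕ → 𝔤) :
    vertexValue B (t :: V) legs φ =
      (-B.form ⁅φ t.1, φ t.2.1⁆ (φ t.2.2)) • vertexValue B V legs φ := by
  simp only [vertexValue, List.map_cons, List.prod_cons, mul_smul]

theorem vertexValue_update (B : LieMetric K 𝔤) (V : List (ℕ × ℕ × ℕ)) (legs : Fin 2 → List ℕ)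
    (φ : ℕ → 𝔤) (p : ℕ) (v : 𝔤) (hV : p ∉ vertEnds V) (h0 : p ∉ legs 0) (h1 : p ∉ legs 1) :
    vertexValue B V legs (Function.update φ p v) = vertexValue B V legs φ := by
  rw [vertexValue, vertexValue, vertProd_update B φ V p v hV, legProd_update φ _ p v h0,
    legProd_update φ _ p v h1]

theorem weight_as (B : LieMetric K 𝔤) (b : Module.Basis ι K 𝔤) {D D' : JacobiDiagram}
    {p q r : ℕ} {V : List (ℕ × ℕ × ℕ)}
    (hV : D.verts = (p, q, r) :: V) (hV' : D'.verts = (q, p, r) :: V)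
    (hE : D'.edges = D.edges) (hL : D'.legs = D.legs) :
    weight B b D + weight B b D' = 0 := by
  have hval : vertexValue B D'.verts D'.legs = fun ψ => -vertexValue B D.verts D.legs ψ := by
    funext ψ
    rw [hV, hV', hL, vertexValue_cons, vertexValue_cons]
    simp only
    rw [← lie_skew (ψ p) (ψ q), map_neg, LinearMap.neg_apply, ← neg_smul]
    simp
  rw [weight, weight, hval, hE, edgeSum_neg, add_neg_cancel]

theorem LieMetric.jacobi (B : LieMetric K 𝔤) (s t u v : 𝔤) :
    B.form ⁅t, s⁆ ⁅u, v⁆ - B.form ⁅s, u⁆ ⁅v, t⁆ + B.form ⁅t, u⁆ ⁅v, s⁆ = 0 := by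
  have h (x y z w : 𝔤) : B.form ⁅x, y⁆ ⁅z, w⁆ = B.form ⁅⁅x, y⁆, z⁆ w := by
    rw [B.rotate ⁅x, y⁆ z w, B.symm.eq]
  have h2 : B.form ⁅s, u⁆ ⁅v, t⁆ = -B.form ⁅⁅s, u⁆, t⁆ v := by
    rw [← h, ← lie_skew v t, map_neg]
  have h3 : B.form ⁅t, u⁆ ⁅v, s⁆ = -B.form ⁅⁅t, u⁆, s⁆ v := by
    rw [← h, ← lie_skew v s, map_neg]
  rw [h t s u v, h2, h3, sub_neg_eq_add, ← LinearMap.add_apply, ← map_add, ← sub_eq_add_neg,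
    ← LinearMap.sub_apply, ← map_sub]
  have : ⁅⁅t, s⁆, u⁆ + ⁅⁅s, u⁆, t⁆ - ⁅⁅t, u⁆, s⁆ = 0 := by
    have hj := lie_jacobi t s u
    rw [← lie_skew ⁅t, s⁆ u, ← lie_skew ⁅s, u⁆ t, ← lie_skew ⁅t, u⁆ s, ← lie_skew t u, lie_neg]
    rw [← neg_eq_zero, ← hj]
    abel
  rw [this, map_zero, LinearMap.zero_apply]

/-- Filling the inner edge between two trivalent vertices. -/
theorem edgeSum_inner (B : LieMetric K 𝔤) (b : Module.Basis ι K 𝔤) (x y p q r s : ℕ)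
    (V : List (ℕ × ℕ × ℕ)) (legs : Fin 2 → List ℕ) (ψ : ℕ → 𝔤)
    (h : (x :: y :: p :: q :: r :: s :: (vertEnds V ++ legs 0 ++ legs 1)).Nodup) :
    edgeSum B b (vertexValue B ((x, p, q) :: (y, r, s) :: V) legs) [(x, y)] ψ =
      B.form ⁅ψ p, ψ q⁆ ⁅ψ r, ψ s⁆ • vertexValue B V legs ψ := by
  simp only [List.nodup_cons, List.mem_cons, List.mem_append, not_or] at h
  obtain ⟨⟨hxy, hxp, hxq, hxr, hxs, ⟨hxV, hx0⟩, hx1⟩, ⟨hyp, hyq, hyr, hys, ⟨hyV, hy0⟩, hy1⟩, -⟩ := h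
  simp only [edgeSum, vertexValue_cons]
  have hv (i j : ι) : vertexValue B V legs
      (Function.update (Function.update ψ x (b i)) y (b j)) = vertexValue B V legs ψ := by
    rw [vertexValue_update B V legs _ y _ hyV hy0 hy1,
      vertexValue_update B V legs _ x _ hxV hx0 hx1]
  simp only [hv, Function.update_self, Function.update_of_ne hxy, Function.update_of_ne (Ne.symm hxp),
    Function.update_of_ne (Ne.symm hxq), Function.update_of_ne (Ne.symm hxr), Function.update_of_ne (Ne.symm hxs),
    Function.update_of_ne (Ne.symm hyp), Function.update_of_ne (Ne.symm hyq), Function.update_of_ne (Ne.symm hyr),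
    Function.update_of_ne (Ne.symm hys)]
  simp only [smul_smul, ← Finset.sum_smul]
  congr 1
  rw [← B.sum_casimir b]
  refine Finset.sum_congr rfl fun i _ => Finset.sum_congr rfl fun j _ => ?_
  rw [B.rotate (b i), B.rotate (b j), B.symm.eq ⁅ψ p, ψ q⁆, B.symm.eq ⁅ψ r, ψ s⁆]
  simp only [neg_mul_neg]

theorem weight_ihx (B : LieMetric K 𝔤) (b : Module.Basis ι K 𝔤) {I H X : JacobiDiagram}
    {x y p q r s : ℕ} {E : List (ℕ × ℕ)} {V : List (ℕ × ℕ × ℕ)}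
    (hE : I.edges = (x, y) :: E)
    (hI : I.verts = (x, q, p) :: (y, r, s) :: V)
    (hH : H.verts = (x, p, r) :: (y, s, q) :: V)
    (hX : X.verts = (x, q, r) :: (y, s, p) :: V)
    (hEH : H.edges = I.edges) (hEX : X.edges = I.edges)
    (hLH : H.legs = I.legs) (hLX : X.legs = I.legs) :
    weight B b I - weight B b H + weight B b X = 0 := by
  have hnd := I.nodup
  have hnd2 := I.perm.nodup hnd
  rw [hE] at hnd
  rw [hI] at hnd2
  simp only [edgeEnds, List.flatMap_cons, List.cons_append, List.nil_append,
    List.nodup_cons, List.mem_cons, not_or] at hnd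
  simp only [vertEnds, List.flatMap_cons, List.cons_append, List.nil_append] at hnd2
  have hx := hnd.1.2
  have hy := hnd.2.1
  have nd (t u v w : ℕ) (hp : ([x, t, u, y, v, w] : List ℕ).Perm [x, q, p, y, r, s]) :
      (x :: y :: t :: u :: v :: w :: (vertEnds V ++ I.legs 0 ++ I.legs 1)).Nodup := by
    have h1 : ([x, y, t, u, v, w] : List ℕ).Perm [x, t, u, y, v, w] :=
      List.Perm.cons _ ((List.perm_middle (a := y) (l₁ := [t, u]) (l₂ := [v, w])).symm)
    exact (((h1.trans hp).symm.append_right (vertEnds V ++ I.legs 0 ++ I.legs 1)).nodup hnd2)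
  rw [weight, weight, weight, hEH, hEX, hLH, hLX, hE, hI, hH, hX,
    edgeSum_cons B b _ x y E 0 hx hy, edgeSum_cons B b _ x y E 0 hx hy,
    edgeSum_cons B b _ x y E 0 hx hy, sub_eq_add_neg, ← edgeSum_neg, ← edgeSum_add,
    ← edgeSum_add]
  rw [← edgeSum_zero (M := UniversalEnvelopingAlgebra K 𝔤 ⊗[K] UniversalEnvelopingAlgebra K 𝔤)
    B b E 0]
  congr 1
  funext ψ
  rw [edgeSum_inner B b x y _ _ _ _ V I.legs ψ (nd q p r s (List.Perm.refl _)),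
    edgeSum_inner B b x y _ _ _ _ V I.legs ψ (nd p r s q (by
      rw [List.perm_iff_count]; intro z; simp only [List.count_cons, List.count_nil]; omega)),
    edgeSum_inner B b x y _ _ _ _ V I.legs ψ (nd q r s p (by
      rw [List.perm_iff_count]; intro z; simp only [List.count_cons, List.count_nil]; omega)),
    ← neg_smul, ← add_smul, ← add_smul, ← sub_eq_add_neg, B.jacobi, zero_smul]

/-- Filling an edge that joins a trivalent vertex to an interval. -/
theorem sum_legProd (B : LieMetric K 𝔤) (b : Module.Basis ι K 𝔤) (x y p q : ℕ) (L R : List ℕ)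
    (ψ : ℕ → 𝔤) (hxy : x ≠ y) (hxp : x ≠ p) (hxq : x ≠ q) (hyp : y ≠ p) (hyq : y ≠ q)
    (hxL : x ∉ L) (hxR : x ∉ R) (hyL : y ∉ L) (hyR : y ∉ R) :
    ∑ i, ∑ j, (B.casimirCoeff b i j *
      -B.form ⁅Function.update (Function.update ψ x (b i)) y (b j) x,
        Function.update (Function.update ψ x (b i)) y (b j) q⁆
        (Function.update (Function.update ψ x (b i)) y (b j) p)) •
      legProd K (Function.update (Function.update ψ x (b i)) y (b j)) (L ++ y :: R) =
    legProd K ψ (L ++ p :: q :: R) - legProd K ψ (L ++ q :: p :: R) := by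
  have hl (φ : ℕ → 𝔤) (l : List ℕ) (z : ℕ) : legProd K φ (L ++ z :: l) =
      legProd K φ L * (UniversalEnvelopingAlgebra.ι K (φ z) * legProd K φ l) := by
    simp [legProd]
  have hc (φ : ℕ → 𝔤) (l : List ℕ) (z : ℕ) : legProd K φ (z :: l) =
      UniversalEnvelopingAlgebra.ι K (φ z) * legProd K φ l := by
    simp [legProd]
  have hu (i j : ι) (l : List ℕ) (h1 : x ∉ l) (h2 : y ∉ l) :
      legProd K (Function.update (Function.update ψ x (b i)) y (b j)) l = legProd K ψ l := by
    rw [legProd_update _ _ _ _ h2, legProd_update _ _ _ _ h1]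
  simp only [hl, hc, hu _ _ L hxL hyL, hu _ _ R hxR hyR, Function.update_self,
    Function.update_of_ne hxy, Function.update_of_ne hxp.symm, Function.update_of_ne hxq.symm,
    Function.update_of_ne hyp.symm, Function.update_of_ne hyq.symm]
  have hz : ∑ i, ∑ j, (B.casimirCoeff b i j * -B.form ⁅b i, ψ q⁆ (ψ p)) • b j =
      ⁅ψ p, ψ q⁆ := by
    have h1 (i : ι) : ∑ j, (B.casimirCoeff b i j * -B.form ⁅b i, ψ q⁆ (ψ p)) • b j =
        B.form (b i) ⁅ψ p, ψ q⁆ • B.dual b i := by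
      rw [← B.dual_eq b i, Finset.smul_sum]
      refine Finset.sum_congr rfl fun j _ => ?_
      rw [smul_smul, B.rotate (b i), ← lie_skew (ψ q) (ψ p), map_neg, LinearMap.neg_apply,
        neg_neg, B.symm.eq ⁅ψ p, ψ q⁆, mul_comm]
    simp only [h1, B.sum_form_dual]
  have h2 : UniversalEnvelopingAlgebra.ι K ⁅ψ p, ψ q⁆ =
      UniversalEnvelopingAlgebra.ι K (ψ p) * UniversalEnvelopingAlgebra.ι K (ψ q) -
      UniversalEnvelopingAlgebra.ι K (ψ q) * UniversalEnvelopingAlgebra.ι K (ψ p) := by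
    let _ : LieRing (UniversalEnvelopingAlgebra K 𝔤) := LieRing.ofAssociativeRing
    exact LieHom.map_lie (UniversalEnvelopingAlgebra.ι K) (ψ p) (ψ q)
  rw [← hz] at h2
  simp only [map_sum, map_smul] at h2
  calc _ = legProd K ψ L * ((∑ i, ∑ j, (B.casimirCoeff b i j * -B.form ⁅b i, ψ q⁆ (ψ p)) •
        UniversalEnvelopingAlgebra.ι K (b j)) * legProd K ψ R) := by
        simp only [Finset.sum_mul, Finset.mul_sum, smul_mul_assoc, mul_smul_comm]
    _ = _ := by
        rw [h2, sub_mul, mul_sub, mul_assoc, mul_assoc]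

theorem weight_stu (B : LieMetric K 𝔤) (b : Module.Basis ι K 𝔤) {S T U : JacobiDiagram}
    {x y p q : ℕ} {i : Fin 2} {L R : List ℕ}
    (hE : S.edges = (x, y) :: T.edges) (hV : S.verts = (x, q, p) :: T.verts)
    (hS : S.legs = Function.update T.legs i (L ++ y :: R))
    (hT : T.legs i = L ++ p :: q :: R)
    (hEU : U.edges = T.edges) (hVU : U.verts = T.verts)
    (hU : U.legs = Function.update T.legs i (L ++ q :: p :: R)) :
    weight B b S - weight B b T + weight B b U = 0 := by
  have hnd := S.nodup
  have hnT (z : ℕ) (hz : z ∉ edgeEnds T.edges) :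
      z ∉ vertEnds T.verts ++ T.legs 0 ++ T.legs 1 := fun h => hz (T.perm.mem_iff.2 h)
  rw [hE] at hnd
  simp only [edgeEnds, List.flatMap_cons, List.cons_append, List.nil_append,
    List.nodup_cons, List.mem_cons, not_or] at hnd
  have hxy := hnd.1.1
  have hx : x ∉ edgeEnds T.edges := hnd.1.2
  have hy : y ∉ edgeEnds T.edges := hnd.2.1
  have hx' := hnT x hx
  have hy' := hnT y hy
  simp only [List.mem_append, not_or] at hx' hy'
  have hxi : x ∉ L ++ p :: q :: R := by
    rw [← hT]; fin_cases i
    exacts [hx'.1.2, hx'.2]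
  have hyi : y ∉ L ++ p :: q :: R := by
    rw [← hT]; fin_cases i
    exacts [hy'.1.2, hy'.2]
  simp only [List.mem_append, List.mem_cons, not_or] at hxi hyi
  have key (ψ : ℕ → 𝔤) : edgeSum B b (vertexValue B S.verts S.legs) [(x, y)] ψ +
      -vertexValue B T.verts T.legs ψ + vertexValue B U.verts U.legs ψ = 0 := by
    have hsum := sum_legProd B b x y p q L R ψ hxy hxi.2.1 hxi.2.2.1 hyi.2.1 hyi.2.2.1
      hxi.1 hxi.2.2.2 hyi.1 hyi.2.2.2
    have hv (k l : ι) := (vertProd_update B (Function.update ψ x (b k)) T.verts y (b l)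
      hy'.1.1).trans (vertProd_update B ψ T.verts x (b k) hx'.1.1)
    simp only [edgeSum, hV, hVU, vertexValue_cons]
    have hlp (k l : ι) (m : List ℕ) (h1 : x ∉ m) (h2 : y ∉ m) :
        legProd K (Function.update (Function.update ψ x (b k)) y (b l)) m = legProd K ψ m := by
      rw [legProd_update _ _ _ _ h2, legProd_update _ _ _ _ h1]
    fin_cases i
    · simp only [Fin.zero_eta] at hS hU hT
      simp only [vertexValue, hS, hU, hT, hv, Function.update_self,
        Function.update_of_ne (show (1 : Fin 2) ≠ 0 by decide), hlp _ _ _ hx'.2 hy'.2]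
      set c := (T.verts.map fun t => -B.form ⁅ψ t.1, ψ t.2.1⁆ (ψ t.2.2)).prod
      have h3 := congrArg (fun z => c • (z ⊗ₜ[K] legProd K ψ (T.legs 1))) hsum
      simp only [TensorProduct.sum_tmul, TensorProduct.sub_tmul, smul_sub, Finset.smul_sum,
        ← TensorProduct.smul_tmul'] at h3
      rw [add_assoc, neg_add_eq_sub, add_eq_zero_iff_eq_neg, neg_sub, ← h3]
      refine Finset.sum_congr rfl fun k _ => Finset.sum_congr rfl fun l _ => ?_
      simp only [smul_smul]
      congr 1
      ring
    · simp only [Fin.mk_one] at hS hU hT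
      simp only [vertexValue, hS, hU, hT, hv, Function.update_self,
        Function.update_of_ne (show (0 : Fin 2) ≠ 1 by decide), hlp _ _ _ hx'.1.2 hy'.1.2]
      set c := (T.verts.map fun t => -B.form ⁅ψ t.1, ψ t.2.1⁆ (ψ t.2.2)).prod
      have h3 := congrArg (fun z => c • (legProd K ψ (T.legs 0) ⊗ₜ[K] z)) hsum
      simp only [TensorProduct.tmul_sum, TensorProduct.tmul_sub, smul_sub, Finset.smul_sum,
        TensorProduct.tmul_smul] at h3
      rw [add_assoc, neg_add_eq_sub, add_eq_zero_iff_eq_neg, neg_sub, ← h3]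
      refine Finset.sum_congr rfl fun k _ => Finset.sum_congr rfl fun l _ => ?_
      simp only [smul_smul]
      congr 1
      ring
  rw [weight, weight, weight, hE, hEU, edgeSum_cons B b _ x y _ 0 hx hy, sub_eq_add_neg,
    ← edgeSum_neg, ← edgeSum_add, ← edgeSum_add]
  simp only [key]
  exact edgeSum_zero B b _ _

theorem jacobiRel_le_ker (B : LieMetric K 𝔤) (b : Module.Basis ι K 𝔤) :
    Submodule.span K {r : JacobiDiagram →₀ K | JacobiRel K r} ≤
      LinearMap.ker (Finsupp.linearCombination K (weight B b)) := by
  rw [Submodule.span_le]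
  rintro r hr
  rw [SetLike.mem_coe, LinearMap.mem_ker]
  cases hr with
  | iso D D' h => simp [weight_iso B b h]
  | as D D' p q r V hV hV' hE hL => simpa using weight_as B b hV hV' hE hL
  | ihx I H X x y p q r s E V hE hI hH hX hEH hEX hLH hLX =>
    simpa using weight_ihx B b hE hI hH hX hEH hEX hLH hLX
  | stu S T U x y p q i L R hE hV hS hT hEU hVU hU =>
    simpa using weight_stu B b hE hV hS hT hEU hVU hU

/-- The universal weight system of a metrized Lie algebra on the space of Jacobi diagrams on two
strands, computed in the basis `b`: the linear map that sends the class of a Jacobi diagram `D` to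
`weight B b D`. -/
noncomputable def weightSystem (B : LieMetric K 𝔤) (b : Module.Basis ι K 𝔤) :
    JacobiSpace K →ₗ[K] UniversalEnvelopingAlgebra K 𝔤 ⊗[K] UniversalEnvelopingAlgebra K 𝔤 :=
  Submodule.liftQ _ (Finsupp.linearCombination K (weight B b)) (jacobiRel_le_ker B b)

end WeightSystem

/-! ### The trace form on `sl₂` -/

/-- The trace form `(x, y) ↦ tr (x y)` on `sl₂`. -/
noncomputable def slTraceForm (K : Type*) [Field K] : LinearMap.BilinForm K (sl (Fin 2) K) :=
  LinearMap.mk₂ K (fun x y => Matrix.trace (x.1 * y.1))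
    (fun x y z => by simp [add_mul]) (fun c x y => by simp)
    (fun x y z => by simp [mul_add]) (fun c x y => by simp)

theorem slTraceForm_separatingLeft (K : Type*) [Field K] [CharZero K] :
    (slTraceForm K).SeparatingLeft := by
  intro x hx
  have hmem (A : Matrix (Fin 2) (Fin 2) K) (hA : A.trace = 0) : (x.1 * A).trace = 0 :=
    hx ⟨A, LinearMap.mem_ker.2 hA⟩
  have ht : x.1.trace = 0 := LinearMap.mem_ker.1 x.2
  have h1 := hmem !![0, 1; 0, 0] (by simp [Matrix.trace_fin_two])
  have h2 := hmem !![0, 0; 1, 0] (by simp [Matrix.trace_fin_two])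
  have h3 := hmem !![1, 0; 0, -1] (by simp [Matrix.trace_fin_two])
  simp [Matrix.trace_fin_two, Matrix.mul_apply, Fin.sum_univ_two] at h1 h2 h3 ht
  have h4 : x.1 0 0 = 0 := by
    have : (2 : K) * x.1 0 0 = 0 := by linear_combination h3 + ht
    simpa using this
  have h5 : x.1 1 1 = 0 := by linear_combination ht - h4
  apply Subtype.ext
  ext i j
  fin_cases i <;> fin_cases j <;> simp [h1, h2, h4, h5]

/-- The metrized Lie algebra `sl₂` with its trace form. -/
noncomputable def slTraceMetric (K : Type*) [Field K] [CharZero K] :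
    LieMetric K (sl (Fin 2) K) where
  form := slTraceForm K
  symm := ⟨fun x y => Matrix.trace_mul_comm x.1 y.1⟩
  nondegenerate := ⟨slTraceForm_separatingLeft K, fun y hy =>
    slTraceForm_separatingLeft K y fun x => by
      rw [← hy x]; exact Matrix.trace_mul_comm y.1 x.1⟩
  invariant x y z := by
    change Matrix.trace (⁅z, x⁆.1 * y.1) + Matrix.trace (x.1 * ⁅z, y⁆.1) = 0
    rw [LieAlgebra.SpecialLinear.sl_bracket, LieAlgebra.SpecialLinear.sl_bracket, sub_mul, mul_sub,
      Matrix.trace_sub, Matrix.trace_sub, ← mul_assoc x.1 y.1 z.1,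
      Matrix.trace_mul_comm (x.1 * y.1) z.1, mul_assoc z.1, mul_assoc x.1 z.1]
    ring

/-! ### Contractions with paired slots -/

/-! The image lies in a commutative subalgebra: the one generated by `C ⊗ 1`, `1 ⊗ C` and `Ω`, where
`C` is the quadratic Casimir element of `U(𝔤)` and `Ω` the Casimir tensor. These generators commute
because `C` is central, and an algebra generated by commuting elements is commutative
(`casimirSubalgebra_commute`).

What is special about `sl₂` is that it has dimension 3. The trilinear form `B([x,y],z)` is therefore
a multiple of the determinant, and the product of two such values is a multiple of the Gram
determinant of the pairings `B(x,u)` (`slTraceMetric_hasGramIdentity`). Two trivalent vertices can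
thus be traded for sums of products of three pairings (`contraction_two_vertices`). The resulting
expressions are no longer weights of Jacobi diagrams, so the induction runs over `contraction`,
which also allows a list `P` of paired slots. A pair is then removed: if its slots lie on one edge
it gives a scalar, otherwise it fuses two edges into one (`contraction_pair_loop`,
`contraction_pair_join`). This leaves at most one trivalent vertex and no pairs.

The remaining cases use induction on the number of legs. By STU, exchanging neighbouring legs
changes a contraction by one with a leg fewer, so modulo the subalgebra the legs on each strand may
be permuted freely. For a single vertex, two of its three edges end on the same strand (or the
contraction vanishes); exchanging their ends changes the sign by antisymmetry but nothing modulo the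
subalgebra, so in characteristic 0 the contraction lies in it (`contraction_mem_of_vertex`). With no
vertex only chords remain; moved to the starts of the strands, a chord splits off as one of the
three generators (`contraction_mem_of_chords`). -/

section Contraction

variable {K 𝔤 ι : Type*} [Field K] [LieRing 𝔤] [LieAlgebra K 𝔤] [Fintype ι] [DecidableEq ι]

section edgeSum

variable {M : Type*} [AddCommGroup M] [Module K M] (B : LieMetric K 𝔤) (b : Module.Basis ι K 𝔤)

theorem edgeSum_smul (c : K) (F : (ℕ → 𝔤) → M) (E : List (ℕ × ℕ)) (φ : ℕ → 𝔤) :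
    edgeSum B b (fun ψ => c • F ψ) E φ = c • edgeSum B b F E φ := by
  induction E generalizing φ with
  | nil => rfl
  | cons e E ih =>
    obtain ⟨p, q⟩ := e
    simp only [edgeSum, ih, Finset.smul_sum]
    refine Finset.sum_congr rfl fun i _ => Finset.sum_congr rfl fun j _ => smul_comm _ _ _

theorem edgeSum_sub (F G : (ℕ → 𝔤) → M) (E : List (ℕ × ℕ)) (φ : ℕ → 𝔤) :
    edgeSum B b (fun ψ => F ψ - G ψ) E φ = edgeSum B b F E φ - edgeSum B b G E φ := by
  simp only [sub_eq_add_neg, edgeSum_add, edgeSum_neg]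

theorem edgeSum_mul_left {A : Type*} [Ring A] [Algebra K A] (m : A) (F : (ℕ → 𝔤) → A)
    (E : List (ℕ × ℕ)) (φ : ℕ → 𝔤) :
    edgeSum B b (fun ψ => m * F ψ) E φ = m * edgeSum B b F E φ := by
  induction E generalizing φ with
  | nil => rfl
  | cons e E ih =>
    obtain ⟨p, q⟩ := e
    simp only [edgeSum, ih, Finset.mul_sum, mul_smul_comm]

end edgeSum

theorem edgeEnds_perm_of_sym2 {E E' : List (ℕ × ℕ)}
    (h : (E.map fun e => s(e.1, e.2)).Perm (E'.map fun e => s(e.1, e.2))) :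
    (edgeEnds E).Perm (edgeEnds E') := by
  -- The multiset of half-edges is a sum over the unordered edges, so it sees neither the order of
  -- the list nor the orientation of an edge.
  have key (E : List (ℕ × ℕ)) : (edgeEnds E : Multiset ℕ) =
      (((E.map fun e => s(e.1, e.2)).map Sym2.toMultiset).sum : Multiset ℕ) := by
    induction E with
    | nil => rfl
    | cons e E ih =>
      simp only [edgeEnds, List.flatMap_cons, List.map_cons, List.sum_cons] at ih ⊢
      rw [← ih]
      rfl
  rw [← Multiset.coe_eq_coe, key, key]
  exact (h.map _).sum_eq

/-- Every half-edge lies on an edge, which can be moved to the front and oriented at will. -/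
theorem exists_edge_cons {E : List (ℕ × ℕ)} {p : ℕ} (hp : p ∈ edgeEnds E) :
    ∃ (q : ℕ) (E' : List (ℕ × ℕ)), (E.map fun e => s(e.1, e.2)).Perm
      (((p, q) :: E').map fun e => s(e.1, e.2)) := by
  obtain ⟨⟨r, s⟩, he, hpe⟩ := List.mem_flatMap.1 hp
  obtain ⟨A, C, rfl⟩ := List.append_of_mem he
  simp only [List.mem_cons, List.not_mem_nil, or_false] at hpe
  have h := (List.perm_middle (a := (r, s)) (l₁ := A) (l₂ := C)).map
    fun e : ℕ × ℕ => s(e.1, e.2)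
  rcases hpe with rfl | rfl
  · exact ⟨s, A ++ C, h⟩
  · refine ⟨r, A ++ C, h.trans ?_⟩
    simp [Sym2.eq_swap]

/-- The contribution of the vertices together with a factor `⟨φ p, φ q⟩` for each pair `(p, q)`
in the list `P`. -/
noncomputable def pairedValue (B : LieMetric K 𝔤) (P : List (ℕ × ℕ)) (V : List (ℕ × ℕ × ℕ))
    (legs : Fin 2 → List ℕ) (φ : ℕ → 𝔤) :
    UniversalEnvelopingAlgebra K 𝔤 ⊗[K] UniversalEnvelopingAlgebra K 𝔤 :=
  (P.map fun e => B.form (φ e.1) (φ e.2)).prod • vertexValue B V legs φ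

/-- The sum over all states of `pairedValue`. -/
noncomputable def contraction (B : LieMetric K 𝔤) (b : Module.Basis ι K 𝔤)
    (E P : List (ℕ × ℕ)) (V : List (ℕ × ℕ × ℕ)) (legs : Fin 2 → List ℕ) :
    UniversalEnvelopingAlgebra K 𝔤 ⊗[K] UniversalEnvelopingAlgebra K 𝔤 :=
  edgeSum B b (pairedValue B P V legs) E 0

/-- Every half-edge lies on exactly one edge, and in exactly one pair or at exactly one vertex. -/
structure IsClosedPattern (E P : List (ℕ × ℕ)) (V : List (ℕ × ℕ × ℕ)) (legs : Fin 2 → List ℕ) :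
    Prop where
  nodup : (edgeEnds E).Nodup
  perm : (edgeEnds E).Perm (edgeEnds P ++ vertEnds V ++ legs 0 ++ legs 1)

theorem pairedValue_nil (B : LieMetric K 𝔤) (V : List (ℕ × ℕ × ℕ)) (legs : Fin 2 → List ℕ) :
    pairedValue B [] V legs = vertexValue B V legs := by
  funext φ
  simp [pairedValue]

theorem pairedValue_cons (B : LieMetric K 𝔤) (p q : ℕ) (P : List (ℕ × ℕ)) (V : List (ℕ × ℕ × ℕ))
    (legs : Fin 2 → List ℕ) (φ : ℕ → 𝔤) :
    pairedValue B ((p, q) :: P) V legs φ = B.form (φ p) (φ q) • pairedValue B P V legs φ := by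
  simp only [pairedValue, List.map_cons, List.prod_cons, mul_smul]

theorem pairedValue_vertex (B : LieMetric K 𝔤) (x y z : ℕ) (P : List (ℕ × ℕ))
    (V : List (ℕ × ℕ × ℕ)) (legs : Fin 2 → List ℕ) (φ : ℕ → 𝔤) :
    pairedValue B P ((x, y, z) :: V) legs φ =
      (-B.form ⁅φ x, φ y⁆ (φ z)) • pairedValue B P V legs φ := by
  simp only [pairedValue, vertexValue_cons]
  rw [smul_comm]

theorem pairedValue_update (B : LieMetric K 𝔤) {P : List (ℕ × ℕ)} {V : List (ℕ × ℕ × ℕ)}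
    {legs : Fin 2 → List ℕ} {p : ℕ} (hp : p ∉ edgeEnds P ++ vertEnds V ++ legs 0 ++ legs 1)
    (φ : ℕ → 𝔤) (v : 𝔤) :
    pairedValue B P V legs (Function.update φ p v) = pairedValue B P V legs φ := by
  simp only [List.mem_append, not_or] at hp
  obtain ⟨⟨⟨hP, hV⟩, h0⟩, h1⟩ := hp
  rw [pairedValue, pairedValue, vertexValue_update B V legs φ p v hV h0 h1]
  congr 2
  refine List.map_congr_left fun t ht => ?_
  have hmem (h : ℕ) (hh : h ∈ [t.1, t.2]) : h ≠ p := fun e =>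
    hP (List.mem_flatMap.2 ⟨t, ht, e ▸ hh⟩)
  rw [Function.update_of_ne (hmem _ (by simp)), Function.update_of_ne (hmem _ (by simp))]

theorem IsClosedPattern.of_sym2 {E E' P : List (ℕ × ℕ)} {V : List (ℕ × ℕ × ℕ)}
    {legs : Fin 2 → List ℕ} (h : IsClosedPattern E P V legs)
    (hE : (E.map fun e => s(e.1, e.2)).Perm (E'.map fun e => s(e.1, e.2))) :
    IsClosedPattern E' P V legs :=
  ⟨(edgeEnds_perm_of_sym2 hE).nodup h.nodup, (edgeEnds_perm_of_sym2 hE).symm.trans h.perm⟩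

theorem contraction_of_sym2 (B : LieMetric K 𝔤) (b : Module.Basis ι K 𝔤)
    {E E' P : List (ℕ × ℕ)} {V : List (ℕ × ℕ × ℕ)}
    {legs : Fin 2 → List ℕ} (h : IsClosedPattern E P V legs)
    (hE : (E.map fun e => s(e.1, e.2)).Perm (E'.map fun e => s(e.1, e.2))) :
    contraction B b E P V legs = contraction B b E' P V legs :=
  edgeSum_sym2 B b _ _ _ h.nodup hE _

/-- A pair whose slots lie on the same edge contributes a scalar. -/
theorem contraction_pair_loop (B : LieMetric K 𝔤) (b : Module.Basis ι K 𝔤)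
    {E P : List (ℕ × ℕ)} {V : List (ℕ × ℕ × ℕ)} {legs : Fin 2 → List ℕ} {p q : ℕ}
    (h : IsClosedPattern ((p, q) :: E) ((p, q) :: P) V legs) :
    IsClosedPattern E P V legs ∧
    contraction B b ((p, q) :: E) ((p, q) :: P) V legs =
      (∑ i, ∑ j, B.casimirCoeff b i j * B.form (b i) (b j)) • contraction B b E P V legs := by
  have hnd := h.nodup
  have hpm := h.perm
  simp only [edgeEnds, List.flatMap_cons, List.cons_append, List.nil_append, List.perm_cons,
    List.nodup_cons, List.mem_cons, not_or] at hnd hpm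
  obtain ⟨⟨hpq, hp⟩, hq, hE⟩ := hnd
  refine ⟨⟨hE, hpm⟩, ?_⟩
  -- The sum over the edge `(p, q)` is moved innermost, where everything except the pairing is
  -- independent of `p` and `q`.
  rw [contraction, edgeSum_cons B b _ p q E 0 hp hq, contraction, ← edgeSum_smul]
  congr 1
  funext ψ
  simp only [edgeSum, pairedValue_cons, Function.update_self, Function.update_of_ne hpq]
  rw [Finset.sum_smul]
  refine Finset.sum_congr rfl fun i _ => ?_
  rw [Finset.sum_smul]
  refine Finset.sum_congr rfl fun j _ => ?_
  rw [pairedValue_update B (fun hh => hq (hpm.mem_iff.2 hh)),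
    pairedValue_update B (fun hh => hp (hpm.mem_iff.2 hh)), mul_smul]

/-- The coefficients form the inverse `G⁻¹` of the Gram matrix `G` of `b`, and this is `G⁻¹ G G⁻¹ =
G⁻¹`. It is the reason why two edges linked by a pairing act as a single edge. -/
theorem LieMetric.sum_casimirCoeff_form (B : LieMetric K 𝔤) (b : Module.Basis ι K 𝔤) (j l : ι) :
    ∑ i, ∑ k, B.casimirCoeff b i j * B.casimirCoeff b k l * B.form (b i) (b k) =
      B.casimirCoeff b j l := by
  have h : B.casimirCoeff b j l = B.form (∑ i, B.casimirCoeff b j i • b i)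
      (∑ k, B.casimirCoeff b l k • b k) := by
    rw [B.dual_eq, B.dual_eq]; rfl
  rw [h]
  simp only [map_sum, LinearMap.sum_apply, map_smul, LinearMap.smul_apply, smul_eq_mul,
    Finset.mul_sum]
  rw [Finset.sum_comm]
  refine Finset.sum_congr rfl fun k _ => Finset.sum_congr rfl fun i _ => ?_
  rw [B.casimirCoeff_comm b l, B.casimirCoeff_comm b j]
  ring

/-- A pair whose slots lie on two edges joins these edges to one. -/
theorem contraction_pair_join (B : LieMetric K 𝔤) (b : Module.Basis ι K 𝔤)
    {E P : List (ℕ × ℕ)} {V : List (ℕ × ℕ × ℕ)} {legs : Fin 2 → List ℕ} {p p' q q' : ℕ}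
    (h : IsClosedPattern ((p, p') :: (q, q') :: E) ((p, q) :: P) V legs) :
    IsClosedPattern ((p', q') :: E) P V legs ∧
    contraction B b ((p, p') :: (q, q') :: E) ((p, q) :: P) V legs =
      contraction B b ((p', q') :: E) P V legs := by
  have hnd := h.nodup
  have hpm := h.perm
  simp only [edgeEnds, List.flatMap_cons, List.cons_append, List.nil_append, List.perm_cons,
    List.nodup_cons, List.mem_cons, not_or] at hnd hpm
  obtain ⟨⟨hpp, hpq, hpq', hp⟩, ⟨hp'q, hp'q', hp'⟩, ⟨hqq', hq⟩, hq', hE⟩ := hnd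
  have hpm' : (p' :: q' :: edgeEnds E).Perm (edgeEnds P ++ vertEnds V ++ legs 0 ++ legs 1) :=
    ((List.Perm.swap p' q _).trans hpm).cons_inv
  refine ⟨⟨?_, hpm'⟩, ?_⟩
  · simp only [edgeEnds, List.flatMap_cons, List.cons_append, List.nil_append,
      List.nodup_cons, List.mem_cons, not_or]
    exact ⟨⟨hp'q', hp'⟩, hq', hE⟩
  have hpn : p ∉ edgeEnds P ++ vertEnds V ++ legs 0 ++ legs 1 := fun hh => by
    have := hpm'.mem_iff.2 hh
    simp only [List.mem_cons] at this
    exact this.elim hpp fun h => h.elim hpq' hp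
  have hqn : q ∉ edgeEnds P ++ vertEnds V ++ legs 0 ++ legs 1 := fun hh => by
    have := hpm'.mem_iff.2 hh
    simp only [List.mem_cons] at this
    exact this.elim (Ne.symm hp'q) fun h => h.elim hqq' hq
  have hout (r : ℕ) (h1 : r ≠ q) (h2 : r ≠ q') (h3 : r ∉ edgeEnds E) :
      r ∉ edgeEnds ((q, q') :: E) := by
    simp only [edgeEnds, List.flatMap_cons, List.cons_append, List.nil_append,
      List.mem_cons, not_or]
    exact ⟨h1, h2, h3⟩
  rw [contraction, edgeSum_cons B b _ p p' _ 0 (hout p hpq hpq' hp) (hout p' hp'q hp'q' hp'),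
    edgeSum_cons B b _ q q' E 0 hq hq', contraction, edgeSum_cons B b _ p' q' E 0 hp' hq']
  congr 1
  funext ψ
  simp only [edgeSum, pairedValue_cons, Function.update_self, Function.update_of_ne hpp,
    Function.update_of_ne (Ne.symm hp'q), Function.update_of_ne (Ne.symm hpq),
    Function.update_of_ne hqq']
  -- The slots `p` and `q` occur only in the removed pair, so their values can be forgotten in the
  -- rest.
  have hv (i j k l : ι) : pairedValue B P V legs (Function.update (Function.update
      (Function.update (Function.update ψ q (b k)) q' (b l)) p (b i)) p' (b j)) =
      pairedValue B P V legs (Function.update (Function.update ψ p' (b j)) q' (b l)) := by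
    rw [Function.update_comm hpp, pairedValue_update B hpn, Function.update_comm hqq',
      Function.update_comm (Ne.symm hp'q), pairedValue_update B hqn,
      Function.update_comm (Ne.symm hp'q')]
  simp only [hv, smul_smul, Finset.smul_sum]
  have hcomm (f : ι → ι → ι → ι →
      UniversalEnvelopingAlgebra K 𝔤 ⊗[K] UniversalEnvelopingAlgebra K 𝔤) :
      ∑ k, ∑ l, ∑ i, ∑ j, f i j k l = ∑ j, ∑ l, ∑ i, ∑ k, f i j k l := by
    calc ∑ k, ∑ l, ∑ i, ∑ j, f i j k l = ∑ l, ∑ k, ∑ i, ∑ j, f i j k l := Finset.sum_comm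
      _ = ∑ l, ∑ k, ∑ j, ∑ i, f i j k l := Finset.sum_congr rfl fun l _ =>
          Finset.sum_congr rfl fun k _ => Finset.sum_comm
      _ = ∑ l, ∑ j, ∑ k, ∑ i, f i j k l := Finset.sum_congr rfl fun l _ => Finset.sum_comm
      _ = ∑ j, ∑ l, ∑ k, ∑ i, f i j k l := Finset.sum_comm
      _ = _ := Finset.sum_congr rfl fun j _ => Finset.sum_congr rfl fun l _ => Finset.sum_comm
  rw [hcomm]
  refine Finset.sum_congr rfl fun j _ => Finset.sum_congr rfl fun l _ => ?_
  simp only [← Finset.sum_smul]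
  congr 1
  rw [← B.sum_casimirCoeff_form b j l]
  refine Finset.sum_congr rfl fun i _ => Finset.sum_congr rfl fun k _ => ?_
  ring

end Contraction

/-! ### Reordering the univalent vertices along a strand -/

section Strands

variable {K 𝔤 ι : Type*} [Field K] [LieRing 𝔤] [LieAlgebra K 𝔤] [Fintype ι] [DecidableEq ι]

/-- The inclusion of the factor of `U(𝔤) ⊗ U(𝔤)` that belongs to the strand `i`. -/
noncomputable def strandIncl (K 𝔤 : Type*) [Field K] [LieRing 𝔤] [LieAlgebra K 𝔤] (i : Fin 2) :
    UniversalEnvelopingAlgebra K 𝔤 →ₐ[K]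
      UniversalEnvelopingAlgebra K 𝔤 ⊗[K] UniversalEnvelopingAlgebra K 𝔤 :=
  if i = 0 then Algebra.TensorProduct.includeLeft else Algebra.TensorProduct.includeRight

theorem strandIncl_zero (u : UniversalEnvelopingAlgebra K 𝔤) :
    strandIncl K 𝔤 0 u = u ⊗ₜ[K] 1 := by
  simp [strandIncl]

theorem strandIncl_one (u : UniversalEnvelopingAlgebra K 𝔤) :
    strandIncl K 𝔤 1 u = 1 ⊗ₜ[K] u := by
  simp [strandIncl]

theorem legProd_append (φ : ℕ → 𝔤) (l m : List ℕ) :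
    legProd K φ (l ++ m) = legProd K φ l * legProd K φ m := by
  simp [legProd]

/-- Multiplication in the tensor square is factorwise, so an initial segment of one strand can be
pulled out on the left whatever stands on the other strand. -/
theorem pairedValue_append (B : LieMetric K 𝔤) (P : List (ℕ × ℕ)) (V : List (ℕ × ℕ × ℕ))
    (legs : Fin 2 → List ℕ) (i : Fin 2) (l m : List ℕ) (φ : ℕ → 𝔤) :
    pairedValue B P V (Function.update legs i (l ++ m)) φ =
      strandIncl K 𝔤 i (legProd K φ l) * pairedValue B P V (Function.update legs i m) φ := by
  fin_cases i
  · simp only [Fin.zero_eta, pairedValue, vertexValue, Function.update_self,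
      Function.update_of_ne (show (1 : Fin 2) ≠ 0 by decide), strandIncl_zero, legProd_append,
      mul_smul_comm, Algebra.TensorProduct.tmul_mul_tmul, one_mul]
  · simp only [Fin.mk_one, pairedValue, vertexValue, Function.update_self,
      Function.update_of_ne (show (0 : Fin 2) ≠ 1 by decide), strandIncl_one, legProd_append,
      mul_smul_comm, Algebra.TensorProduct.tmul_mul_tmul, one_mul]

/-- Here `1 - i` is the other strand; this form lets counting arguments treat both strands at once.
-/
theorem legs_append_perm (legs : Fin 2 → List ℕ) (i : Fin 2) (l : List ℕ) :
    (Function.update legs i l 0 ++ Function.update legs i l 1).Perm (l ++ legs (1 - i)) := by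
  fin_cases i
  · simp
  · simpa using List.perm_append_comm

theorem pattern_ends_update_perm (E : List ℕ) (legs : Fin 2 → List ℕ) (i : Fin 2) (l : List ℕ) :
    (E ++ Function.update legs i l 0 ++ Function.update legs i l 1).Perm
      (l ++ (E ++ legs (1 - i))) := by
  rw [List.append_assoc]
  refine ((legs_append_perm legs i l).append_left E).trans ?_
  rw [← List.append_assoc, ← List.append_assoc]
  exact List.perm_append_comm.append_right _

theorem IsClosedPattern.perm_legs {E P : List (ℕ × ℕ)} {V : List (ℕ × ℕ × ℕ)}
    {legs : Fin 2 → List ℕ} {i : Fin 2} {l m : List ℕ}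
    (h : IsClosedPattern E P V (Function.update legs i l)) (hlm : l.Perm m) :
    IsClosedPattern E P V (Function.update legs i m) :=
  ⟨h.nodup, h.perm.trans ((pattern_ends_update_perm _ legs i l).trans
    ((hlm.append_right _).trans (pattern_ends_update_perm _ legs i m).symm))⟩

/-- The STU relation for contractions. -/
theorem exists_contraction_swap (B : LieMetric K 𝔤) (b : Module.Basis ι K 𝔤)
    {E P : List (ℕ × ℕ)} {V : List (ℕ × ℕ × ℕ)} {legs : Fin 2 → List ℕ} {i : Fin 2}
    {p q : ℕ} {L R : List ℕ}
    (h : IsClosedPattern E P V (Function.update legs i (L ++ p :: q :: R))) :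
    ∃ (x y : ℕ),
      IsClosedPattern ((x, y) :: E) P ((x, q, p) :: V) (Function.update legs i (L ++ y :: R)) ∧
      contraction B b ((x, y) :: E) P ((x, q, p) :: V) (Function.update legs i (L ++ y :: R)) =
      contraction B b E P V (Function.update legs i (L ++ p :: q :: R)) -
        contraction B b E P V (Function.update legs i (L ++ q :: p :: R)) := by
  -- Two fresh labels serve as the half-edges of the new edge that joins the new trivalent vertex to
  -- the strand.
  obtain ⟨x, hx⟩ := Infinite.exists_notMem_finset (edgeEnds E).toFinset
  obtain ⟨y, hy⟩ := Infinite.exists_notMem_finset (x :: edgeEnds E).toFinset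
  simp only [List.mem_toFinset, List.mem_cons, not_or] at hx hy
  have hyx := hy.1
  replace hy := hy.2
  have hends := h.perm.trans (pattern_ends_update_perm _ legs i _)
  have hx' : x ∉ L ++ p :: q :: R ++ (edgeEnds P ++ vertEnds V ++ legs (1 - i)) :=
    fun hh => hx (hends.mem_iff.2 hh)
  have hy' : y ∉ L ++ p :: q :: R ++ (edgeEnds P ++ vertEnds V ++ legs (1 - i)) :=
    fun hh => hy (hends.mem_iff.2 hh)
  refine ⟨x, y, ⟨?_, ?_⟩, ?_⟩
  · simp only [edgeEnds, List.flatMap_cons, List.cons_append, List.nil_append,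
      List.nodup_cons, List.mem_cons, not_or]
    exact ⟨⟨Ne.symm hyx, hx⟩, hy, h.nodup⟩
  · refine List.Perm.trans ?_ (pattern_ends_update_perm _ legs i _).symm
    have h1 : (edgeEnds ((x, y) :: E)).Perm
        (x :: y :: (L ++ p :: q :: R ++ (edgeEnds P ++ vertEnds V ++ legs (1 - i)))) :=
      (hends.cons y).cons x
    refine h1.trans ?_
    rw [List.perm_iff_count]
    intro z
    simp only [vertEnds, List.flatMap_cons, List.count_append, List.count_cons, List.count_nil]
    omega
  · rw [contraction, edgeSum_cons B b _ x y E 0 hx hy, contraction, contraction, ← edgeSum_sub]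
    congr 1
    funext ψ
    simp only [List.mem_append, List.mem_cons, not_or] at hx' hy'
    have hsum := sum_legProd B b x y p q L R ψ (Ne.symm hyx) hx'.1.2.1 hx'.1.2.2.1 hy'.1.2.1
      hy'.1.2.2.1 hx'.1.1 hx'.1.2.2.2 hy'.1.1 hy'.1.2.2.2
    -- Once the whole strand `i` is split off, the remaining factor does not involve `x` and `y`.
    -- The sum over the new edge then only meets the new vertex and the strand product, where
    -- `sum_legProd` produces the commutator.
    have hnil (l : List ℕ) (φ : ℕ → 𝔤) := pairedValue_append B P V legs i l [] φ
    simp only [List.append_nil] at hnil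
    have hout (z : ℕ) (hz : z ∉ edgeEnds P ++ vertEnds V ++ legs (1 - i)) :
        z ∉ edgeEnds P ++ vertEnds V ++ Function.update legs i [] 0 ++
          Function.update legs i [] 1 := fun hh =>
      hz (by simpa using (pattern_ends_update_perm _ legs i []).mem_iff.1 hh)
    have hv (j k : ι) : pairedValue B P V (Function.update legs i [])
        (Function.update (Function.update ψ x (b j)) y (b k)) =
        pairedValue B P V (Function.update legs i []) ψ := by
      rw [pairedValue_update B (hout y (by simpa [not_or, and_assoc] using hy'.2)),
        pairedValue_update B (hout x (by simpa [not_or, and_assoc] using hx'.2))]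
    simp only [edgeSum, pairedValue_vertex, hnil (L ++ y :: R), hnil (L ++ p :: q :: R),
      hnil (L ++ q :: p :: R), hv]
    rw [← sub_mul, ← map_sub, ← hsum]
    simp only [map_sum, map_smul, Finset.sum_mul, smul_mul_assoc, smul_smul]

/-- Modulo a subspace that contains the contractions with fewer legs, the legs on a strand can be
permuted. -/
theorem contraction_sub_mem_of_perm (B : LieMetric K 𝔤) (b : Module.Basis ι K 𝔤)
    (S : Submodule K (UniversalEnvelopingAlgebra K 𝔤 ⊗[K] UniversalEnvelopingAlgebra K 𝔤))
    {n : ℕ} (hS : ∀ E P V legs, IsClosedPattern E P V legs →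
      (legs 0).length + (legs 1).length < n → contraction B b E P V legs ∈ S)
    {E P : List (ℕ × ℕ)} {V : List (ℕ × ℕ × ℕ)} {legs : Fin 2 → List ℕ} {i : Fin 2}
    {l m : List ℕ} (hlm : l.Perm m) (Q : List ℕ)
    (h : IsClosedPattern E P V (Function.update legs i (Q ++ l)))
    (hn : (Q ++ l).length + (legs (1 - i)).length ≤ n) :
    contraction B b E P V (Function.update legs i (Q ++ l)) -
      contraction B b E P V (Function.update legs i (Q ++ m)) ∈ S := by
  induction hlm generalizing Q with
  | nil => simp
  | cons x _ ih =>
    -- The prefix `Q` is arbitrary so that it can absorb the common first leg.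
    have := ih (Q ++ [x]) (by simpa using h) (by simpa using hn)
    simpa using this
  | swap x y l =>
    -- The difference is a contraction with one more vertex but one leg fewer, hence in `S`, where
    -- the number of vertices is not bounded.
    obtain ⟨u, v, hp, heq⟩ := exists_contraction_swap B b h
    rw [← heq]
    refine hS _ _ _ _ hp ?_
    have h1 := (legs_append_perm legs i (Q ++ v :: l)).length_eq
    simp only [List.length_append, List.length_cons] at h1 hn
    omega
  | trans h1 h2 ih1 ih2 =>
    have := S.add_mem (ih1 Q h hn) (ih2 Q (h.perm_legs (h1.append_left Q))
      (by simpa [h1.length_eq] using hn))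
    simpa using this

theorem contraction_mem_iff_of_perm (B : LieMetric K 𝔤) (b : Module.Basis ι K 𝔤)
    (S : Submodule K (UniversalEnvelopingAlgebra K 𝔤 ⊗[K] UniversalEnvelopingAlgebra K 𝔤))
    {n : ℕ} (hS : ∀ E P V legs, IsClosedPattern E P V legs →
      (legs 0).length + (legs 1).length < n → contraction B b E P V legs ∈ S)
    {E P : List (ℕ × ℕ)} {V : List (ℕ × ℕ × ℕ)} {legs : Fin 2 → List ℕ} {i : Fin 2}
    {m : List ℕ} (h : IsClosedPattern E P V legs) (hlm : (legs i).Perm m)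
    (hn : (legs 0).length + (legs 1).length ≤ n) :
    contraction B b E P V legs ∈ S ↔ contraction B b E P V (Function.update legs i m) ∈ S := by
  have h1 := (legs_append_perm legs i (legs i)).length_eq
  have h2 := contraction_sub_mem_of_perm B b S hS hlm [] (E := E) (P := P) (V := V) (legs := legs)
    (i := i) (by simpa using h) (by
      simp only [Function.update_eq_self, List.length_append, List.nil_append] at h1 ⊢
      omega)
  simp only [List.nil_append, Function.update_eq_self] at h2
  exact ⟨fun h3 => by simpa using S.sub_mem h3 h2, fun h3 => by simpa using S.add_mem h2 h3⟩

end Strands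

/-! ### Patterns with a single trivalent vertex -/

section Vertex

variable {K 𝔤 ι : Type*} [Field K] [LieRing 𝔤] [LieAlgebra K 𝔤] [Fintype ι] [DecidableEq ι]

theorem IsClosedPattern.vertex_rotate {E P : List (ℕ × ℕ)} {V : List (ℕ × ℕ × ℕ)}
    {legs : Fin 2 → List ℕ} {x y z : ℕ} (h : IsClosedPattern E P ((x, y, z) :: V) legs) :
    IsClosedPattern E P ((y, z, x) :: V) legs := by
  refine ⟨h.nodup, h.perm.trans ?_⟩
  rw [List.perm_iff_count]
  intro w
  simp only [vertEnds, List.flatMap_cons, List.count_append, List.count_cons, List.count_nil]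
  omega

theorem contraction_vertex_rotate (B : LieMetric K 𝔤) (b : Module.Basis ι K 𝔤)
    (E P : List (ℕ × ℕ)) (V : List (ℕ × ℕ × ℕ)) (legs : Fin 2 → List ℕ) (x y z : ℕ) :
    contraction B b E P ((x, y, z) :: V) legs = contraction B b E P ((y, z, x) :: V) legs := by
  rw [contraction, contraction]
  congr 1
  funext φ
  rw [pairedValue_vertex, pairedValue_vertex, B.rotate]

/-- A trivalent vertex with two half-edges on the same edge contributes zero. -/
theorem contraction_vertex_loop [CharZero K] (B : LieMetric K 𝔤) (b : Module.Basis ι K 𝔤)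
    {E P : List (ℕ × ℕ)} {V : List (ℕ × ℕ × ℕ)} {legs : Fin 2 → List ℕ} {x y z : ℕ}
    (h : IsClosedPattern ((x, y) :: E) P ((x, y, z) :: V) legs) :
    contraction B b ((x, y) :: E) P ((x, y, z) :: V) legs = 0 := by
  have hnd := h.nodup
  simp only [edgeEnds, List.flatMap_cons, List.cons_append, List.nil_append,
    List.nodup_cons, List.mem_cons, not_or] at hnd
  obtain ⟨⟨hxy, hx⟩, hy, -⟩ := hnd
  have hpm : (edgeEnds E).Perm (z :: (edgeEnds P ++ vertEnds V ++ legs 0 ++ legs 1)) := by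
    have := h.perm
    rw [List.perm_iff_count] at this ⊢
    intro w
    have := this w
    simp only [edgeEnds, vertEnds, List.flatMap_cons, List.count_append, List.count_cons,
      List.count_nil] at this ⊢
    omega
  have hx' : x ∉ z :: (edgeEnds P ++ vertEnds V ++ legs 0 ++ legs 1) :=
    fun hh => hx (hpm.mem_iff.2 hh)
  have hy' : y ∉ z :: (edgeEnds P ++ vertEnds V ++ legs 0 ++ legs 1) :=
    fun hh => hy (hpm.mem_iff.2 hh)
  rw [List.mem_cons, not_or] at hx' hy'
  rw [contraction, edgeSum_cons B b _ x y E 0 hx hy]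
  refine Eq.trans ?_ (edgeSum_zero B b E 0)
  congr 1
  funext ψ
  simp only [edgeSum, pairedValue_vertex, pairedValue_update B hx'.2, pairedValue_update B hy'.2,
    Function.update_self, Function.update_of_ne hxy, Function.update_of_ne (Ne.symm hx'.1),
    Function.update_of_ne (Ne.symm hy'.1), smul_smul, ← Finset.sum_smul]
  -- The bracket is antisymmetric and the Casimir tensor symmetric, so the sum equals its own
  -- negative and vanishes in characteristic 0.
  have h2 : ∑ i, ∑ j, B.casimirCoeff b i j * -B.form ⁅b i, b j⁆ (ψ z) =
      -∑ i, ∑ j, B.casimirCoeff b i j * -B.form ⁅b i, b j⁆ (ψ z) := by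
    conv_lhs => rw [Finset.sum_comm]
    simp only [← Finset.sum_neg_distrib]
    refine Finset.sum_congr rfl fun i _ => Finset.sum_congr rfl fun j _ => ?_
    rw [B.casimirCoeff_comm b j i, ← lie_skew (b i) (b j), map_neg, LinearMap.neg_apply]
    ring
  rw [self_eq_neg.1 h2, zero_smul]

theorem pairedValue_comp (B : LieMetric K 𝔤) (P : List (ℕ × ℕ)) (V : List (ℕ × ℕ × ℕ))
    (legs : Fin 2 → List ℕ) (f : ℕ → ℕ) (φ : ℕ → 𝔤) :
    pairedValue B P V legs (φ ∘ f) = pairedValue B (P.map fun e => (f e.1, f e.2))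
      (V.map fun t => (f t.1, f t.2.1, f t.2.2)) (fun i => (legs i).map f) φ := by
  simp [pairedValue, vertexValue, legProd_comp, Function.comp_def]

/-- Exchanging the ends of two edges at a trivalent vertex changes the sign. -/
theorem contraction_vertex_swap (B : LieMetric K 𝔤) (b : Module.Basis ι K 𝔤)
    {E : List (ℕ × ℕ)} {legs : Fin 2 → List ℕ} {i : Fin 2} {x x' y y' z : ℕ} {L : List ℕ}
    (h : IsClosedPattern ((x, x') :: (y, y') :: E) [] [(x, y, z)]
      (Function.update legs i (x' :: y' :: L))) :
    contraction B b ((x, x') :: (y, y') :: E) [] [(x, y, z)]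
      (Function.update legs i (y' :: x' :: L)) =
    -contraction B b ((x, x') :: (y, y') :: E) [] [(x, y, z)]
      (Function.update legs i (x' :: y' :: L)) := by
  have hnd := h.nodup
  have hpm := h.perm.trans (pattern_ends_update_perm _ legs i _)
  have hnd2 := hpm.nodup hnd
  simp only [edgeEnds, vertEnds, List.flatMap_cons, List.flatMap_nil, List.append_nil,
    List.cons_append, List.nil_append, List.nodup_cons, List.mem_cons, List.mem_append,
    not_or] at hnd hnd2
  obtain ⟨⟨hxx', hxy, hxy', hx⟩, ⟨hx'y, hx'y', hx'⟩, ⟨hyy', hy⟩, hy', -⟩ := hnd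
  obtain ⟨⟨-, hx'L, -, -, hx'z, hx'R⟩, ⟨hy'L, -, -, hy'z, hy'R⟩, hnd2⟩ := hnd2
  have hnd3 := List.nodup_append.1 hnd2
  obtain ⟨-, hnd4, hdis⟩ := hnd3
  simp only [List.nodup_cons, List.mem_cons, not_or] at hnd4
  obtain ⟨⟨-, hxz, hxR⟩, ⟨hyz, hyR⟩, -⟩ := hnd4
  have hxL : x ∉ L := fun hh => hdis x hh x (by simp) rfl
  have hyL : y ∉ L := fun hh => hdis y hh y (by simp) rfl
  -- This relabelling exchanges the edges `(x, x')` and `(y, y')` as wholes. The state sum is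
  -- invariant under it; its effect is to exchange the two legs and to reverse the vertex, which
  -- gives the sign.
  let f : Equiv.Perm ℕ := Equiv.swap x y * Equiv.swap x' y'
  have hf (w : ℕ) (h1 : w ≠ x) (h2 : w ≠ y) (h3 : w ≠ x') (h4 : w ≠ y') : f w = w := by
    simp only [f, Equiv.Perm.mul_apply, Equiv.swap_apply_of_ne_of_ne h3 h4,
      Equiv.swap_apply_of_ne_of_ne h1 h2]
  have hfx : f x = y := by
    simp only [f, Equiv.Perm.mul_apply, Equiv.swap_apply_of_ne_of_ne hxx' hxy',
      Equiv.swap_apply_left]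
  have hfy : f y = x := by
    simp only [f, Equiv.Perm.mul_apply, Equiv.swap_apply_of_ne_of_ne (Ne.symm hx'y) hyy',
      Equiv.swap_apply_right]
  have hfx' : f x' = y' := by
    simp only [f, Equiv.Perm.mul_apply, Equiv.swap_apply_left,
      Equiv.swap_apply_of_ne_of_ne (Ne.symm hxy') (Ne.symm hyy')]
  have hfy' : f y' = x' := by
    simp only [f, Equiv.Perm.mul_apply, Equiv.swap_apply_right,
      Equiv.swap_apply_of_ne_of_ne (Ne.symm hxx') hx'y]
  have hfl (l : List ℕ) (h1 : x ∉ l) (h2 : y ∉ l) (h3 : x' ∉ l) (h4 : y' ∉ l) :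
      l.map f = l := by
    conv_rhs => rw [← List.map_id l]
    exact List.map_congr_left fun w hw => hf w (fun e => h1 (e ▸ hw)) (fun e => h2 (e ▸ hw))
      (fun e => h3 (e ▸ hw)) fun e => h4 (e ▸ hw)
  have hfE : (E.map fun e => (f e.1, f e.2)) = E := by
    conv_rhs => rw [← List.map_id E]
    refine List.map_congr_left fun e he => ?_
    have hmem (w : ℕ) (hw : w ∈ [e.1, e.2]) : f w = w := by
      have hw' : w ∈ E.flatMap fun e => [e.1, e.2] := List.mem_flatMap.2 ⟨e, he, hw⟩
      exact hf w (fun e => hx (e ▸ hw')) (fun e => hy (e ▸ hw'))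
        (fun e => hx' (e ▸ hw')) fun e => hy' (e ▸ hw')
    rw [hmem _ (by simp), hmem _ (by simp)]
    rfl
  have hlegs : (fun j => (Function.update legs i (y' :: x' :: L) j).map f) =
      Function.update legs i (x' :: y' :: L) := by
    funext j
    by_cases hj : j = i
    · subst hj
      simp only [Function.update_self, List.map_cons, hfx', hfy', hfl L hxL hyL hx'L hy'L]
    · have hj' : j = 1 - i := by
        fin_cases i <;> fin_cases j <;> simp_all
      rw [Function.update_of_ne hj, Function.update_of_ne hj, hj']
      exact hfl _ hxR hyR hx'R hy'R
  have hrel := edgeSum_relabel B b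
    (pairedValue B [] [(x, y, z)] (Function.update legs i (y' :: x' :: L))) f
    ((x, x') :: (y, y') :: E) 0
  have hneg : (fun ψ : ℕ → 𝔤 => pairedValue B [] [(x, y, z)]
      (Function.update legs i (y' :: x' :: L)) (ψ ∘ f)) =
      fun ψ => -pairedValue B [] [(x, y, z)] (Function.update legs i (x' :: y' :: L)) ψ := by
    funext ψ
    rw [pairedValue_comp, hlegs]
    simp only [List.map_cons, List.map_nil, hfx, hfy,
      hf z (Ne.symm hxz) (Ne.symm hyz) (Ne.symm hx'z) (Ne.symm hy'z), pairedValue_vertex]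
    rw [← lie_skew (ψ x) (ψ y), map_neg, LinearMap.neg_apply, neg_neg, neg_smul]
  rw [hneg, edgeSum_neg] at hrel
  simp only [List.map_cons, hfx, hfy, hfx', hfy', hfE] at hrel
  rw [edgeSum_swap B b _ y y' x x' E 0 (Ne.symm hxy) (Ne.symm hx'y) (Ne.symm hxy')
    (Ne.symm hx'y')] at hrel
  exact hrel.symm

/-- Two edges at the only trivalent vertex that end on the same strand. -/
theorem contraction_mem_of_vertex_of_strand [CharZero K] (B : LieMetric K 𝔤)
    (b : Module.Basis ι K 𝔤)
    (S : Submodule K (UniversalEnvelopingAlgebra K 𝔤 ⊗[K] UniversalEnvelopingAlgebra K 𝔤))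
    {n : ℕ} (hS : ∀ E P V legs, IsClosedPattern E P V legs →
      (legs 0).length + (legs 1).length < n → contraction B b E P V legs ∈ S)
    {E : List (ℕ × ℕ)} {legs : Fin 2 → List ℕ} {x x' y y' z : ℕ}
    (h : IsClosedPattern ((x, x') :: (y, y') :: E) [] [(x, y, z)] legs)
    (hn : (legs 0).length + (legs 1).length ≤ n) {i : Fin 2} (hx : x' ∈ legs i)
    (hy : y' ∈ legs i) :
    contraction B b ((x, x') :: (y, y') :: E) [] [(x, y, z)] legs ∈ S := by
  have hne : y' ≠ x' := fun e => by
    have := h.nodup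
    simp [edgeEnds, e] at this
  have hp : (legs i).Perm (x' :: y' :: ((legs i).erase x').erase y') :=
    (List.perm_cons_erase hx).trans
      ((List.perm_cons_erase ((List.mem_erase_of_ne hne).2 hy)).cons x')
  set L := ((legs i).erase x').erase y'
  have h1 : IsClosedPattern ((x, x') :: (y, y') :: E) [] [(x, y, z)]
      (Function.update legs i (x' :: y' :: L)) :=
    IsClosedPattern.perm_legs (legs := legs) (by rwa [Function.update_eq_self]) hp
  rw [contraction_mem_iff_of_perm B b S hS h hp hn]
  -- Exchanging the two neighbouring ends changes the contraction by an element of `S`, yet also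
  -- negates it. So twice the contraction lies in `S`, and 2 is invertible.
  have h3 := contraction_sub_mem_of_perm B b S hS (List.Perm.swap y' x' L) [] (i := i) h1 (by
    have h4 := (legs_append_perm legs i (legs i)).length_eq
    have h5 := hp.length_eq
    simp only [Function.update_eq_self, List.length_append, List.nil_append] at h4 ⊢
    omega)
  simp only [List.nil_append] at h3
  rw [contraction_vertex_swap B b h1, sub_neg_eq_add, ← two_smul K] at h3
  simpa using S.smul_mem (2⁻¹ : K) h3

theorem vertexEnds_mem_legs {p : ℕ} {x y z : ℕ} {legs : Fin 2 → List ℕ}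
    (h : p ∈ edgeEnds [] ++ vertEnds [(x, y, z)] ++ legs 0 ++ legs 1) (hx : p ≠ x) (hy : p ≠ y)
    (hz : p ≠ z) : ∃ i, p ∈ legs i := by
  simp only [edgeEnds, vertEnds, List.flatMap_cons, List.flatMap_nil, List.append_nil,
    List.nil_append, List.cons_append, List.mem_cons, List.mem_append, hx, hy, hz,
    false_or] at h
  exact h.elim (fun h => ⟨0, h⟩) fun h => ⟨1, h⟩

/-- If two half-edges of the vertex share an edge, the contraction vanishes. Otherwise its three
edges end on two strands, so two of them end on the same one, and the cyclic symmetry of the vertex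
makes these the first two. -/
theorem contraction_mem_of_vertex [CharZero K] (B : LieMetric K 𝔤)
    (b : Module.Basis ι K 𝔤)
    (S : Submodule K (UniversalEnvelopingAlgebra K 𝔤 ⊗[K] UniversalEnvelopingAlgebra K 𝔤))
    {n : ℕ} (hS : ∀ E P V legs, IsClosedPattern E P V legs →
      (legs 0).length + (legs 1).length < n → contraction B b E P V legs ∈ S)
    {E : List (ℕ × ℕ)} {legs : Fin 2 → List ℕ} {x y z : ℕ}
    (h : IsClosedPattern E [] [(x, y, z)] legs)
    (hn : (legs 0).length + (legs 1).length ≤ n) :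
    contraction B b E [] [(x, y, z)] legs ∈ S := by
  have hnd := h.perm.nodup h.nodup
  have hV : x ≠ y ∧ x ≠ z ∧ y ≠ z := by
    simp only [edgeEnds, vertEnds, List.flatMap_cons, List.flatMap_nil, List.append_nil,
      List.cons_append, List.nil_append, List.nodup_cons, List.mem_cons, not_or] at hnd
    exact ⟨hnd.1.1, hnd.1.2.1, hnd.2.1.1⟩
  obtain ⟨hxy, hxz, hyz⟩ := hV
  have hmem (w : ℕ) (hw : w ∈ [x, y, z]) : w ∈ edgeEnds E := by
    refine h.perm.mem_iff.2 ?_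
    simp only [List.mem_append]
    exact Or.inl (Or.inl (Or.inr (by simpa [vertEnds] using hw)))
  obtain ⟨x', E₁, hE₁⟩ := exists_edge_cons (hmem x (by simp))
  have h1 := h.of_sym2 hE₁
  rw [contraction_of_sym2 B b h hE₁]
  by_cases hx'y : x' = y
  · subst hx'y
    rw [contraction_vertex_loop B b h1]
    exact S.zero_mem
  by_cases hx'z : x' = z
  · subst hx'z
    have hfl : (((x, x') :: E₁).map fun e => s(e.1, e.2)).Perm
      (((x', x) :: E₁).map fun e => s(e.1, e.2)) := by simp [Sym2.eq_swap]
    rw [contraction_of_sym2 B b h1 hfl, contraction_vertex_rotate, contraction_vertex_rotate,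
      contraction_vertex_loop B b (h1.of_sym2 hfl).vertex_rotate.vertex_rotate]
    exact S.zero_mem
  have hmem1 (w : ℕ) (hw : w ∈ [y, z]) : w ∈ edgeEnds E₁ := by
    have h2 := (edgeEnds_perm_of_sym2 hE₁).mem_iff.1 (hmem w (List.mem_cons_of_mem _ hw))
    simp only [edgeEnds, List.flatMap_cons, List.cons_append, List.nil_append,
      List.mem_cons] at h2
    simp only [List.mem_cons, List.not_mem_nil, or_false] at hw
    rcases h2 with h2 | h2 | h2
    · rcases hw with rfl | rfl
      exacts [absurd h2.symm hxy, absurd h2.symm hxz]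
    · rcases hw with rfl | rfl
      exacts [absurd h2.symm hx'y, absurd h2.symm hx'z]
    · exact h2
  obtain ⟨y', E₂, hE₂⟩ := exists_edge_cons (hmem1 y (by simp))
  have hE₂' : (((x, x') :: E₁).map fun e => s(e.1, e.2)).Perm
      (((x, x') :: (y, y') :: E₂).map fun e => s(e.1, e.2)) := hE₂.cons _
  have h2 := h1.of_sym2 hE₂'
  rw [contraction_of_sym2 B b h1 hE₂']
  have hrot : (((x, x') :: (y, y') :: E₂).map fun e => s(e.1, e.2)).Perm
      (((y, y') :: (x, x') :: E₂).map fun e => s(e.1, e.2)) := List.Perm.swap _ _ _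
  by_cases hy'z : y' = z
  · subst hy'z
    rw [contraction_of_sym2 B b h2 hrot, contraction_vertex_rotate,
      contraction_vertex_loop B b (h2.of_sym2 hrot).vertex_rotate]
    exact S.zero_mem
  have hz2 : z ∈ edgeEnds E₂ := by
    have h3 := (edgeEnds_perm_of_sym2 hE₂).mem_iff.1 (hmem1 z (by simp))
    simp only [edgeEnds, List.flatMap_cons, List.cons_append, List.nil_append,
      List.mem_cons] at h3
    rcases h3 with h3 | h3 | h3
    exacts [absurd h3.symm hyz, absurd h3.symm hy'z, h3]
  obtain ⟨z', E₃, hE₃⟩ := exists_edge_cons hz2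
  have hE₃' : (((x, x') :: (y, y') :: E₂).map fun e => s(e.1, e.2)).Perm
      (((x, x') :: (y, y') :: (z, z') :: E₃).map fun e => s(e.1, e.2)) := (hE₃.cons _).cons _
  have h3 := h2.of_sym2 hE₃'
  rw [contraction_of_sym2 B b h2 hE₃']
  have hnd3 := h3.nodup
  simp only [edgeEnds, List.flatMap_cons, List.cons_append, List.nil_append, List.nodup_cons,
    List.mem_cons, not_or] at hnd3
  obtain ⟨i, hi⟩ := vertexEnds_mem_legs ((h3.perm.mem_iff (a := x')).1 (by simp [edgeEnds]))
    (by tauto) (by tauto) (by tauto)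
  obtain ⟨j, hj⟩ := vertexEnds_mem_legs ((h3.perm.mem_iff (a := y')).1 (by simp [edgeEnds]))
    (by grind) (by grind) (by grind)
  obtain ⟨k, hk⟩ := vertexEnds_mem_legs ((h3.perm.mem_iff (a := z')).1 (by simp [edgeEnds]))
    (by grind) (by grind) (by grind)
  -- The pigeonhole principle for the strands `i`, `j`, `k` on which the three edges end.
  by_cases hij : i = j
  · subst hij
    exact contraction_mem_of_vertex_of_strand B b S hS h3 hn hi hj
  by_cases hjk : j = k
  · subst hjk
    have hp : (((x, x') :: (y, y') :: (z, z') :: E₃).map fun e => s(e.1, e.2)).Perm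
        (((y, y') :: (z, z') :: (x, x') :: E₃).map fun e => s(e.1, e.2)) :=
      (List.perm_middle (l₁ := [s(y, y'), s(z, z')])).symm
    rw [contraction_of_sym2 B b h3 hp, contraction_vertex_rotate]
    exact contraction_mem_of_vertex_of_strand B b S hS (h3.of_sym2 hp).vertex_rotate hn hj hk
  have hik : k = i := by omega
  subst hik
  have hp : (((x, x') :: (y, y') :: (z, z') :: E₃).map fun e => s(e.1, e.2)).Perm
      (((z, z') :: (x, x') :: (y, y') :: E₃).map fun e => s(e.1, e.2)) :=
    List.perm_middle (l₁ := [s(x, x'), s(y, y')])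
  rw [contraction_of_sym2 B b h3 hp, contraction_vertex_rotate, contraction_vertex_rotate]
  exact contraction_mem_of_vertex_of_strand B b S hS
    (h3.of_sym2 hp).vertex_rotate.vertex_rotate hn hk hi

end Vertex

/-! ### Casimir elements and the commutative subalgebra they generate -/

section Casimir

variable {K 𝔤 ι : Type*} [Field K] [LieRing 𝔤] [LieAlgebra K 𝔤] [Fintype ι] [DecidableEq ι]

/-- The quadratic Casimir element of `U(𝔤)`. -/
noncomputable def casimir (B : LieMetric K 𝔤) (b : Module.Basis ι K 𝔤) :
    UniversalEnvelopingAlgebra K 𝔤 :=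
  ∑ i, ∑ j, B.casimirCoeff b i j •
    (UniversalEnvelopingAlgebra.ι K (b i) * UniversalEnvelopingAlgebra.ι K (b j))

/-- The quadratic Casimir tensor in `U(𝔤) ⊗ U(𝔤)`. -/
noncomputable def casimirTensor (B : LieMetric K 𝔤) (b : Module.Basis ι K 𝔤) :
    UniversalEnvelopingAlgebra K 𝔤 ⊗[K] UniversalEnvelopingAlgebra K 𝔤 :=
  ∑ i, ∑ j, B.casimirCoeff b i j •
    (UniversalEnvelopingAlgebra.ι K (b i) ⊗ₜ[K] UniversalEnvelopingAlgebra.ι K (b j))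

/-- The subalgebra of `U(𝔤) ⊗ U(𝔤)` generated by the Casimir elements of the two factors and the
Casimir tensor. -/
noncomputable def casimirSubalgebra (B : LieMetric K 𝔤) (b : Module.Basis ι K 𝔤) :
    Subalgebra K (UniversalEnvelopingAlgebra K 𝔤 ⊗[K] UniversalEnvelopingAlgebra K 𝔤) :=
  Algebra.adjoin K {strandIncl K 𝔤 0 (casimir B b), strandIncl K 𝔤 1 (casimir B b),
    casimirTensor B b}

theorem strandIncl_casimir_mem (B : LieMetric K 𝔤) (b : Module.Basis ι K 𝔤) (i : Fin 2) :
    strandIncl K 𝔤 i (casimir B b) ∈ casimirSubalgebra B b := by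
  refine Algebra.subset_adjoin ?_
  fin_cases i <;> simp

theorem casimirTensor_mem (B : LieMetric K 𝔤) (b : Module.Basis ι K 𝔤) :
    casimirTensor B b ∈ casimirSubalgebra B b :=
  Algebra.subset_adjoin (by simp)

theorem ι_lie (x y : 𝔤) : UniversalEnvelopingAlgebra.ι K ⁅x, y⁆ =
    UniversalEnvelopingAlgebra.ι K x * UniversalEnvelopingAlgebra.ι K y -
      UniversalEnvelopingAlgebra.ι K y * UniversalEnvelopingAlgebra.ι K x := by
  let _ : LieRing (UniversalEnvelopingAlgebra K 𝔤) := LieRing.ofAssociativeRing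
  exact LieHom.map_lie (UniversalEnvelopingAlgebra.ι K) x y

theorem LieMetric.form_eq_sum_dual (B : LieMetric K 𝔤) (b : Module.Basis ι K 𝔤) (z : 𝔤) :
    ∑ i, B.form (B.dual b i) z • b i = z := by
  have h (i : ι) : B.form (B.dual b i) z • b i =
      ∑ j, B.form (b j) z • B.casimirCoeff b j i • b i := by
    rw [← B.dual_eq b i]
    simp only [map_sum, LinearMap.sum_apply, map_smul, LinearMap.smul_apply, smul_eq_mul,
      Finset.sum_smul, smul_smul]
    exact Finset.sum_congr rfl fun j _ => by rw [B.casimirCoeff_comm, mul_comm]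
  simp only [h]
  rw [Finset.sum_comm]
  simp only [← Finset.smul_sum, B.dual_eq, B.sum_form_dual]

theorem casimir_eq_sum_dual (B : LieMetric K 𝔤) (b : Module.Basis ι K 𝔤) :
    casimir B b = ∑ i, UniversalEnvelopingAlgebra.ι K (b i) *
      UniversalEnvelopingAlgebra.ι K (B.dual b i) := by
  refine Finset.sum_congr rfl fun i _ => ?_
  rw [← B.dual_eq b i, map_sum, Finset.mul_sum]
  simp only [map_smul, mul_smul_comm]

/-- The commutator with `x` acts as a derivation on the products `b i * B.dual b i`. Expanded in the
two dual bases, `ad x` has opposite coefficients on the two factors by invariance of the form, so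
the contributions cancel. Since `𝔤` generates `U(𝔤)`, this is the centrality of the Casimir element.
-/
theorem commute_casimir_ι (B : LieMetric K 𝔤) (b : Module.Basis ι K 𝔤) (x : 𝔤) :
    Commute (casimir B b) (UniversalEnvelopingAlgebra.ι K x) := by
  have h1 : ∑ i, UniversalEnvelopingAlgebra.ι K ⁅x, b i⁆ *
        UniversalEnvelopingAlgebra.ι K (B.dual b i) +
      ∑ i, UniversalEnvelopingAlgebra.ι K (b i) *
        UniversalEnvelopingAlgebra.ι K ⁅x, B.dual b i⁆ = 0 := by
    have hl (i : ι) : UniversalEnvelopingAlgebra.ι K ⁅x, b i⁆ *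
        UniversalEnvelopingAlgebra.ι K (B.dual b i) =
        ∑ j, B.form (B.dual b j) ⁅x, b i⁆ • (UniversalEnvelopingAlgebra.ι K (b j) *
          UniversalEnvelopingAlgebra.ι K (B.dual b i)) := by
      conv_lhs => rw [← B.form_eq_sum_dual b ⁅x, b i⁆]
      simp only [map_sum, map_smul, Finset.sum_mul, smul_mul_assoc]
    have hr (i : ι) : UniversalEnvelopingAlgebra.ι K (b i) *
        UniversalEnvelopingAlgebra.ι K ⁅x, B.dual b i⁆ =
        ∑ j, B.form (b j) ⁅x, B.dual b i⁆ • (UniversalEnvelopingAlgebra.ι K (b i) *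
          UniversalEnvelopingAlgebra.ι K (B.dual b j)) := by
      conv_lhs => rw [← B.sum_form_dual b ⁅x, B.dual b i⁆]
      simp only [map_sum, map_smul, Finset.mul_sum, mul_smul_comm]
    simp only [hl, hr]
    rw [Finset.sum_comm, ← Finset.sum_add_distrib]
    refine Finset.sum_eq_zero fun j _ => ?_
    rw [← Finset.sum_add_distrib]
    refine Finset.sum_eq_zero fun i _ => ?_
    rw [← add_smul]
    have := B.invariant (b i) (B.dual b j) x
    rw [B.symm.eq (b i) ⁅x, B.dual b j⁆] at this
    rw [B.symm.eq (B.dual b j), B.symm.eq (b i), this, zero_smul]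
  have h2 : UniversalEnvelopingAlgebra.ι K x * casimir B b -
      casimir B b * UniversalEnvelopingAlgebra.ι K x = 0 := by
    rw [← h1, casimir_eq_sum_dual, Finset.mul_sum, Finset.sum_mul, ← Finset.sum_sub_distrib,
      ← Finset.sum_add_distrib]
    refine Finset.sum_congr rfl fun i _ => ?_
    rw [ι_lie, ι_lie]
    noncomm_ring
  exact (sub_eq_zero.1 h2).symm

theorem commute_casimirTensor (B : LieMetric K 𝔤) (b : Module.Basis ι K 𝔤) (i : Fin 2) :
    Commute (strandIncl K 𝔤 i (casimir B b)) (casimirTensor B b) := by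
  refine Commute.sum_right _ _ _ fun j _ => Commute.sum_right _ _ _ fun k _ =>
    Commute.smul_right ?_ _
  fin_cases i
  · simp only [Fin.zero_eta, strandIncl_zero, Commute, SemiconjBy,
      Algebra.TensorProduct.tmul_mul_tmul, one_mul, mul_one, (commute_casimir_ι B b (b j)).eq]
  · simp only [Fin.mk_one, strandIncl_one, Commute, SemiconjBy,
      Algebra.TensorProduct.tmul_mul_tmul, one_mul, mul_one, (commute_casimir_ι B b (b k)).eq]

/-- It suffices to compare generators: the two Casimir elements live in different tensor factors,
and each commutes with the Casimir tensor. -/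
theorem casimirSubalgebra_commute (B : LieMetric K 𝔤) (b : Module.Basis ι K 𝔤)
    {u v : UniversalEnvelopingAlgebra K 𝔤 ⊗[K] UniversalEnvelopingAlgebra K 𝔤}
    (hu : u ∈ casimirSubalgebra B b) (hv : v ∈ casimirSubalgebra B b) : u * v = v * u := by
  have h01 : Commute (strandIncl K 𝔤 0 (casimir B b)) (strandIncl K 𝔤 1 (casimir B b)) := by
    simp [strandIncl_zero, strandIncl_one, Commute, SemiconjBy]
  have h0 := commute_casimirTensor B b 0
  have h1 := commute_casimirTensor B b 1
  refine Algebra.commute_of_mem_adjoin_of_forall_mem_commute hv fun y hy => ?_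
  refine (Algebra.commute_of_mem_adjoin_of_forall_mem_commute hu fun x hx => ?_).symm
  simp only [Set.mem_insert_iff, Set.mem_singleton_iff] at hx hy
  rcases hx with rfl | rfl | rfl <;> rcases hy with rfl | rfl | rfl
  exacts [Commute.refl _, h01.symm, h0.symm, h01, Commute.refl _, h1.symm, h0, h1,
    Commute.refl _]

/-! ### Splitting off chords -/

/-- A chord with neighbouring ends at the start of a strand splits off a Casimir element. -/
theorem contraction_chord (B : LieMetric K 𝔤) (b : Module.Basis ι K 𝔤)
    {E P : List (ℕ × ℕ)} {V : List (ℕ × ℕ × ℕ)} {legs : Fin 2 → List ℕ} {i : Fin 2}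
    {p q : ℕ} {L : List ℕ}
    (h : IsClosedPattern ((p, q) :: E) P V (Function.update legs i (p :: q :: L))) :
    IsClosedPattern E P V (Function.update legs i L) ∧
    contraction B b ((p, q) :: E) P V (Function.update legs i (p :: q :: L)) =
      strandIncl K 𝔤 i (casimir B b) * contraction B b E P V (Function.update legs i L) := by
  have hnd := h.nodup
  simp only [edgeEnds, List.flatMap_cons, List.cons_append, List.nil_append,
    List.nodup_cons, List.mem_cons, not_or] at hnd
  obtain ⟨⟨hpq, hp⟩, hq, hE⟩ := hnd
  have hpm : (edgeEnds E).Perm (edgeEnds P ++ vertEnds V ++ Function.update legs i L 0 ++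
      Function.update legs i L 1) := by
    have h1 := (h.perm.trans (pattern_ends_update_perm _ legs i _))
    simp only [edgeEnds, List.flatMap_cons, List.cons_append, List.nil_append,
      List.perm_cons] at h1
    exact h1.trans (pattern_ends_update_perm _ legs i L).symm
  refine ⟨⟨hE, hpm⟩, ?_⟩
  rw [contraction, edgeSum_cons B b _ p q E 0 hp hq, contraction, ← edgeSum_mul_left]
  congr 1
  funext ψ
  have happ (φ : ℕ → 𝔤) := pairedValue_append B P V legs i [p, q] L φ
  simp only [List.cons_append, List.nil_append] at happ
  simp only [edgeSum, happ, pairedValue_update B (fun hh => hq (hpm.mem_iff.2 hh)),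
    pairedValue_update B (fun hh => hp (hpm.mem_iff.2 hh))]
  simp only [legProd, List.map_cons, List.map_nil, List.prod_cons, List.prod_nil, mul_one,
    Function.update_self, Function.update_of_ne hpq, casimir, map_sum, map_smul, Finset.sum_mul,
    smul_mul_assoc]

/-- A chord that joins the starts of the two strands splits off a Casimir tensor. -/
theorem contraction_cross_chord (B : LieMetric K 𝔤) (b : Module.Basis ι K 𝔤)
    {E P : List (ℕ × ℕ)} {V : List (ℕ × ℕ × ℕ)} {legs : Fin 2 → List ℕ}
    {p q : ℕ} {L R : List ℕ}
    (h : IsClosedPattern ((p, q) :: E) P V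
      (Function.update (Function.update legs 0 (p :: L)) 1 (q :: R))) :
    IsClosedPattern E P V (Function.update (Function.update legs 0 L) 1 R) ∧
    contraction B b ((p, q) :: E) P V
      (Function.update (Function.update legs 0 (p :: L)) 1 (q :: R)) =
      casimirTensor B b *
        contraction B b E P V (Function.update (Function.update legs 0 L) 1 R) := by
  have hnd := h.nodup
  simp only [edgeEnds, List.flatMap_cons, List.cons_append, List.nil_append,
    List.nodup_cons, List.mem_cons, not_or] at hnd
  obtain ⟨⟨hpq, hp⟩, hq, hE⟩ := hnd
  have h01 : (0 : Fin 2) ≠ 1 := by decide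
  have hpm : (edgeEnds E).Perm (edgeEnds P ++ vertEnds V ++
      Function.update (Function.update legs 0 L) 1 R 0 ++
      Function.update (Function.update legs 0 L) 1 R 1) := by
    have h1 := h.perm
    rw [List.perm_iff_count] at h1 ⊢
    intro w
    have := h1 w
    simp only [edgeEnds, List.flatMap_cons, List.count_append, List.count_cons,
      List.count_nil, Function.update_self, Function.update_of_ne h01] at this ⊢
    omega
  refine ⟨⟨hE, hpm⟩, ?_⟩
  rw [contraction, edgeSum_cons B b _ p q E 0 hp hq, contraction, ← edgeSum_mul_left]
  congr 1
  funext ψ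
  have happ (φ : ℕ → 𝔤) : pairedValue B P V
      (Function.update (Function.update legs 0 (p :: L)) 1 (q :: R)) φ =
      (UniversalEnvelopingAlgebra.ι K (φ p) ⊗ₜ[K] UniversalEnvelopingAlgebra.ι K (φ q)) *
        pairedValue B P V (Function.update (Function.update legs 0 L) 1 R) φ := by
    have h1 := pairedValue_append B P V (Function.update legs 0 (p :: L)) 1 [q] R φ
    have h2 := pairedValue_append B P V (Function.update legs 1 R) 0 [p] L φ
    simp only [List.cons_append, List.nil_append] at h1 h2
    rw [h1, Function.update_comm h01, h2, Function.update_comm h01, ← mul_assoc]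
    simp [strandIncl_zero, strandIncl_one, legProd]
  simp only [edgeSum, happ, pairedValue_update B (fun hh => hq (hpm.mem_iff.2 hh)),
    pairedValue_update B (fun hh => hp (hpm.mem_iff.2 hh)), Function.update_self,
    Function.update_of_ne hpq, casimirTensor, Finset.sum_mul, smul_mul_assoc]

/-- Without pairs and vertices every edge is a chord. Modulo contractions with fewer legs its ends
can be moved to the starts of their strands, where it splits off a generator; the cofactor has two
legs fewer and is covered by `hS`. -/
theorem contraction_mem_of_chords (B : LieMetric K 𝔤) (b : Module.Basis ι K 𝔤)
    {n : ℕ} (hS : ∀ E P V legs, IsClosedPattern E P V legs →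
      (legs 0).length + (legs 1).length < n → contraction B b E P V legs ∈ casimirSubalgebra B b)
    {E : List (ℕ × ℕ)} {legs : Fin 2 → List ℕ} (h : IsClosedPattern E [] [] legs)
    (hn : (legs 0).length + (legs 1).length ≤ n) :
    contraction B b E [] [] legs ∈ casimirSubalgebra B b := by
  cases E with
  | nil =>
    have h1 := h.perm
    simp only [edgeEnds, vertEnds, List.flatMap_nil, List.nil_append, List.nil_perm,
      List.append_eq_nil_iff] at h1
    simp only [contraction, edgeSum, pairedValue, vertexValue, legProd, h1.1, h1.2, List.map_nil,
      List.prod_nil, one_smul]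
    exact (casimirSubalgebra B b).one_mem
  | cons e E =>
    obtain ⟨p, q⟩ := e
    have hpq : p ≠ q := fun e => by
      have := h.nodup
      simp [edgeEnds, e] at this
    have hmem (w : ℕ) (hw : w ∈ [p, q]) : ∃ i, w ∈ legs i := by
      have h1 := (h.perm.mem_iff (a := w)).1 (by
        simp only [edgeEnds, List.flatMap_cons, List.mem_append]; exact Or.inl hw)
      simp only [edgeEnds, vertEnds, List.flatMap_nil, List.nil_append, List.mem_append] at h1
      exact h1.elim (fun h => ⟨0, h⟩) fun h => ⟨1, h⟩
    obtain ⟨i, hi⟩ := hmem p (by simp)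
    obtain ⟨j, hj⟩ := hmem q (by simp)
    -- The ends are quantified afresh so that a chord listed from strand 1 to strand 0 can be
    -- reversed first.
    have hcross (E : List (ℕ × ℕ)) (p q : ℕ) (h : IsClosedPattern ((p, q) :: E) [] [] legs)
        (hp : p ∈ legs 0) (hq : q ∈ legs 1) :
        contraction B b ((p, q) :: E) [] [] legs ∈ casimirSubalgebra B b := by
      have h0 := List.perm_cons_erase hp
      have h1 := List.perm_cons_erase hq
      have hl0 := h0.length_eq
      have hl1 := h1.length_eq
      simp only [List.length_cons] at hl0 hl1
      have hc0 : IsClosedPattern ((p, q) :: E) [] []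
          (Function.update legs 0 (p :: (legs 0).erase p)) :=
        IsClosedPattern.perm_legs (legs := legs) (by rwa [Function.update_eq_self]) h0
      have h1' : (Function.update legs 0 (p :: (legs 0).erase p) 1).Perm
          (q :: (legs 1).erase q) := by
        rwa [Function.update_of_ne (show (1 : Fin 2) ≠ 0 by decide)]
      have hc1 := IsClosedPattern.perm_legs (i := 1)
        (legs := Function.update legs 0 (p :: (legs 0).erase p))
        (by rwa [Function.update_eq_self]) h1'
      have hin1 := contraction_mem_iff_of_perm B b (casimirSubalgebra B b).toSubmodule hS h h0 hn
      have hin2 := contraction_mem_iff_of_perm B b (casimirSubalgebra B b).toSubmodule hS hc0 h1'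
        (by simp only [Function.update_self, List.length_cons,
              Function.update_of_ne (show (1 : Fin 2) ≠ 0 by decide)]
            omega)
      simp only [Subalgebra.mem_toSubmodule] at hin1 hin2
      obtain ⟨hc, heq⟩ := contraction_cross_chord B b hc1
      rw [hin1, hin2, heq]
      refine (casimirSubalgebra B b).mul_mem (casimirTensor_mem B b) (hS _ _ _ _ hc ?_)
      simp only [Function.update_self, Function.update_of_ne (show (0 : Fin 2) ≠ 1 by decide)]
      omega
    by_cases hij : i = j
    · subst hij
      have hp : (legs i).Perm (p :: q :: ((legs i).erase p).erase q) :=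
        (List.perm_cons_erase hi).trans
          ((List.perm_cons_erase ((List.mem_erase_of_ne (Ne.symm hpq)).2 hj)).cons p)
      have hc : IsClosedPattern ((p, q) :: E) [] []
          (Function.update legs i (p :: q :: ((legs i).erase p).erase q)) :=
        IsClosedPattern.perm_legs (legs := legs) (by rwa [Function.update_eq_self]) hp
      have hin := contraction_mem_iff_of_perm B b (casimirSubalgebra B b).toSubmodule hS h hp hn
      simp only [Subalgebra.mem_toSubmodule] at hin
      obtain ⟨hc', heq⟩ := contraction_chord B b hc
      rw [hin, heq]
      refine (casimirSubalgebra B b).mul_mem (strandIncl_casimir_mem B b i) (hS _ _ _ _ hc' ?_)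
      have h1 := (legs_append_perm legs i (legs i)).length_eq
      have h2 := (legs_append_perm legs i (((legs i).erase p).erase q)).length_eq
      have h3 := hp.length_eq
      simp only [Function.update_eq_self, List.length_append, List.length_cons] at h1 h2 h3
      omega
    · have hfl : (((p, q) :: E).map fun e => s(e.1, e.2)).Perm
        (((q, p) :: E).map fun e => s(e.1, e.2)) := by simp [Sym2.eq_swap]
      have hcase : (i = 0 ∧ j = 1) ∨ (i = 1 ∧ j = 0) := by omega
      rcases hcase with ⟨rfl, rfl⟩ | ⟨rfl, rfl⟩
      · exact hcross E p q h hi hj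
      · rw [contraction_of_sym2 B b h hfl]
        exact hcross E q p (h.of_sym2 hfl) hj hi

/-! ### The Gram identity and the reduction of all contractions -/

/-- The product of two values of the invariant trilinear form is a multiple of the determinant of
the pairings, as for `𝔰𝔩₂`. -/
def LieMetric.HasGramIdentity (B : LieMetric K 𝔤) (κ : K) : Prop :=
  ∀ x y z u v w : 𝔤, B.form ⁅x, y⁆ z * B.form ⁅u, v⁆ w = κ *
    (B.form x u * B.form y v * B.form z w - B.form x u * B.form y w * B.form z v -
      B.form x v * B.form y u * B.form z w + B.form x v * B.form y w * B.form z u +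
      B.form x w * B.form y u * B.form z v - B.form x w * B.form y v * B.form z u)

/-- The Gram identity holds state by state and the state sum is linear; the minus signs of the two
vertices cancel. -/
theorem contraction_two_vertices {B : LieMetric K 𝔤} {κ : K} (hκ : B.HasGramIdentity κ)
    (b : Module.Basis ι K 𝔤) (E P : List (ℕ × ℕ)) (V : List (ℕ × ℕ × ℕ))
    (legs : Fin 2 → List ℕ) (x y z u v w : ℕ) :
    contraction B b E P ((x, y, z) :: (u, v, w) :: V) legs = κ •
      (contraction B b E ((x, u) :: (y, v) :: (z, w) :: P) V legs -
        contraction B b E ((x, u) :: (y, w) :: (z, v) :: P) V legs -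
        contraction B b E ((x, v) :: (y, u) :: (z, w) :: P) V legs +
        contraction B b E ((x, v) :: (y, w) :: (z, u) :: P) V legs +
        contraction B b E ((x, w) :: (y, u) :: (z, v) :: P) V legs -
        contraction B b E ((x, w) :: (y, v) :: (z, u) :: P) V legs) := by
  simp only [contraction]
  simp only [← edgeSum_add, ← edgeSum_sub, ← edgeSum_smul]
  congr 1
  funext φ
  simp only [pairedValue_vertex, pairedValue_cons, smul_smul, ← sub_smul, ← add_smul]
  congr 1
  have := hκ (φ x) (φ y) (φ z) (φ u) (φ v) (φ w)
  linear_combination this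

/-- All contractions lie in the subalgebra generated by the Casimir elements. -/
theorem contraction_mem_casimirSubalgebra [CharZero K] {B : LieMetric K 𝔤} {κ : K}
    (hκ : B.HasGramIdentity κ) (b : Module.Basis ι K 𝔤) (E P : List (ℕ × ℕ))
    (V : List (ℕ × ℕ × ℕ)) (legs : Fin 2 → List ℕ) (h : IsClosedPattern E P V legs) :
    contraction B b E P V legs ∈ casimirSubalgebra B b := by
  -- The outer induction must leave `E`, `P` and `V` free, because STU trades a leg for a new
  -- vertex.
  induction hn : (legs 0).length + (legs 1).length using Nat.strong_induction_on
    generalizing E P V legs with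
  | _ n IH =>
  have hS : ∀ E P V legs, IsClosedPattern E P V legs →
      (legs 0).length + (legs 1).length < n →
      contraction B b E P V legs ∈ casimirSubalgebra B b :=
    fun E P V legs h hlt => IH _ hlt E P V legs h rfl
  -- With the legs fixed, this measure drops by 1 both when two vertices become three pairs (from 4
  -- to 3) and when a pair is removed.
  induction hm : 2 * V.length + P.length using Nat.strong_induction_on
    generalizing E P V with
  | _ m IH' =>
  match V, P with
  | (x, y, z) :: (u, v, w) :: V, P =>
    rw [contraction_two_vertices hκ]
    have hmem (p₁ q₁ p₂ q₂ p₃ q₃ : ℕ)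
        (hp : List.Perm [p₁, q₁, p₂, q₂, p₃, q₃] [x, y, z, u, v, w]) :
        contraction B b E ((p₁, q₁) :: (p₂, q₂) :: (p₃, q₃) :: P) V legs ∈
          casimirSubalgebra B b := by
      refine IH' _ ?_ _ _ _ ⟨h.nodup, h.perm.trans ?_⟩ rfl
      · rw [← hm]
        simp only [List.length_cons]
        omega
      · rw [List.perm_iff_count] at hp ⊢
        intro a
        have := hp a
        simp only [edgeEnds, vertEnds, List.flatMap_cons, List.count_append, List.count_cons,
          List.count_nil] at this ⊢
        omega
    have hperm (l : List ℕ) (hl : ∀ a, l.count a = [x, y, z, u, v, w].count a) :=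
      List.perm_iff_count.2 hl
    refine (casimirSubalgebra B b).smul_mem (sub_mem (add_mem (add_mem (sub_mem (sub_mem
      ?_ ?_) ?_) ?_) ?_) ?_) κ <;>
    · refine hmem _ _ _ _ _ _ (hperm _ fun a => ?_)
      simp only [List.count_cons, List.count_nil]
      omega
  | V, (p, q) :: P =>
    have hnd := h.perm.nodup h.nodup
    have hpq : q ≠ p := fun e => by simp [edgeEnds, e] at hnd
    obtain ⟨p', E₁, hE₁⟩ := exists_edge_cons
      ((h.perm.mem_iff (a := p)).2 (by simp [edgeEnds]))
    rw [contraction_of_sym2 B b h hE₁]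
    have h1 := h.of_sym2 hE₁
    have hlt : 2 * V.length + P.length < m := by
      rw [← hm]
      simp only [List.length_cons]
      omega
    -- Either the edge at `p` closes up at `q`, or `q` lies on a second edge that is joined to the
    -- first.
    by_cases hp'q : p' = q
    · subst hp'q
      obtain ⟨hc, heq⟩ := contraction_pair_loop B b h1
      rw [heq]
      exact (casimirSubalgebra B b).smul_mem (IH' _ hlt _ _ _ hc rfl) _
    · have hq := (h1.perm.mem_iff (a := q)).2 (by simp [edgeEnds])
      simp only [edgeEnds, List.flatMap_cons, List.cons_append, List.nil_append,
        List.mem_cons, hpq, Ne.symm hp'q, false_or] at hq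
      obtain ⟨q', E₂, hE₂⟩ := exists_edge_cons hq
      have hE₂' : (((p, p') :: E₁).map fun e => s(e.1, e.2)).Perm
        (((p, p') :: (q, q') :: E₂).map fun e => s(e.1, e.2)) := hE₂.cons _
      rw [contraction_of_sym2 B b h1 hE₂']
      obtain ⟨hc, heq⟩ := contraction_pair_join B b (h1.of_sym2 hE₂')
      rw [heq]
      exact IH' _ hlt _ _ _ hc rfl
  | [(x, y, z)], [] =>
    exact contraction_mem_of_vertex B b (casimirSubalgebra B b).toSubmodule hS h hn.le
  | [], [] => exact contraction_mem_of_chords B b hS h hn.le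

theorem weight_mem_casimirSubalgebra [CharZero K] {B : LieMetric K 𝔤} {κ : K}
    (hκ : B.HasGramIdentity κ) (b : Module.Basis ι K 𝔤) (D : JacobiDiagram) :
    weight B b D ∈ casimirSubalgebra B b := by
  have h := contraction_mem_casimirSubalgebra hκ b D.edges [] D.verts D.legs
    ⟨D.nodup, D.perm⟩
  rwa [contraction, pairedValue_nil] at h

theorem weightSystem_mem_casimirSubalgebra [CharZero K] {B : LieMetric K 𝔤} {κ : K}
    (hκ : B.HasGramIdentity κ) (b : Module.Basis ι K 𝔤) (a : JacobiSpace K) :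
    weightSystem B b a ∈ casimirSubalgebra B b := by
  obtain ⟨c, rfl⟩ := Submodule.Quotient.mk_surjective _ a
  rw [weightSystem, Submodule.liftQ_apply, Finsupp.linearCombination_apply]
  exact sum_mem fun D _ =>
    (casimirSubalgebra B b).smul_mem (weight_mem_casimirSubalgebra hκ b D) _

end Casimir

/-! ### The case of `sl₂` -/

/-- In the coordinates given by the entries `(0,0)`, `(0,1)`, `(1,0)`, the trilinear form is `2
det(x, y, z)`, while the trace form has Gram matrix of determinant `-2`. The product of two
trilinear values is thus `4 det · det`, and the determinant of the pairings is `-2 det · det`; their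
ratio is `-2`. -/
theorem slTraceMetric_hasGramIdentity (K : Type*) [Field K] [CharZero K] :
    (slTraceMetric K).HasGramIdentity (-2) := by
  have hform (x y : sl (Fin 2) K) : (slTraceMetric K).form x y =
      2 * (x.1 0 0 * y.1 0 0) + x.1 0 1 * y.1 1 0 + x.1 1 0 * y.1 0 1 := by
    have hx : x.1.trace = 0 := LinearMap.mem_ker.1 x.2
    have hy : y.1.trace = 0 := LinearMap.mem_ker.1 y.2
    rw [Matrix.trace_fin_two] at hx hy
    change Matrix.trace (x.1 * y.1) = _
    simp only [Matrix.trace_fin_two, Matrix.mul_apply, Fin.sum_univ_two]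
    linear_combination y.1 1 1 * hx - x.1 0 0 * hy
  have htri (x y z : sl (Fin 2) K) : (slTraceMetric K).form ⁅x, y⁆ z =
      2 * (x.1 0 0 * (y.1 0 1 * z.1 1 0 - y.1 1 0 * z.1 0 1) -
        x.1 0 1 * (y.1 0 0 * z.1 1 0 - y.1 1 0 * z.1 0 0) +
        x.1 1 0 * (y.1 0 0 * z.1 0 1 - y.1 0 1 * z.1 0 0)) := by
    have hx : x.1.trace = 0 := LinearMap.mem_ker.1 x.2
    have hy : y.1.trace = 0 := LinearMap.mem_ker.1 y.2
    rw [Matrix.trace_fin_two, add_comm, add_eq_zero_iff_eq_neg] at hx hy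
    rw [hform, LieAlgebra.SpecialLinear.sl_bracket]
    simp only [Matrix.sub_apply, Matrix.mul_apply, Fin.sum_univ_two, hx, hy]
    ring
  intro x y z u v w
  simp only [htri, hform]
  ring

/-- The image of the universal `sl₂` weight system on two strands, with respect to the trace form
and computed in any basis of `sl₂`, is commutative. -/
theorem proposition4p8 (K : Type*) [Field K] [CharZero K] {ι : Type*} [Fintype ι] [DecidableEq ι]
    (b : Module.Basis ι K (sl (Fin 2) K)) :
    ∀ u ∈ LinearMap.range (weightSystem (slTraceMetric K) b),
      ∀ v ∈ LinearMap.range (weightSystem (slTraceMetric K) b), u * v = v * u := by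
  rintro _ ⟨u, rfl⟩ _ ⟨v, rfl⟩
  have hκ := slTraceMetric_hasGramIdentity K
  exact casimirSubalgebra_commute _ b (weightSystem_mem_casimirSubalgebra hκ b u)
    (weightSystem_mem_casimirSubalgebra hκ b v)
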